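/- Let $K>0$ and $Q\ge 0$. There are constants $A,B>0$, depending only on $K$ and $Q$, such that for every $\rho\in(-1,1)$ and every function $\varphi:\mathbb R\to\mathbb R$ with $\varphi(T)\to 0$ as $T\to\infty$ there is a constant $C>0$, depending only on $K,Q,\rho,\varphi$, with the following property. Let $n\ge 1$, and let $X=(X_{jk})_{1\le j,k\le n}$ be a real random matrix on some probability space such that (a) the random vectors $(X_{jk},X_{kj})$, $1\le j<k\le n$, are mutually independent, and the diagonal $(X_{jj})_{1\le j\le n}$ is independent of the family of off-diagonal entries; (b) $\mathbb E X_{jk}=0$ and $\mathbb E X_{jk}^2=1$ for all $1\le j,k\le n$; (c) $\mathbb E X_{jk}X_{kj}=\rho$ for all $1\le j<k\le n$; (d) the squares of the entries are uniformly integrable with modulus $\varphi$, that is, $\max_{j,k}\mathbb E |X_{jk}|^2\mathbf 1\{|X_{jk}|>T\}\le\varphi(T)$ for all $T\in\mathbb R$. Let $M_n$ be a deterministic real or complex $n\times n$ matrix with operator norm $\|M_n\|\le Kn^Q$ (with respect to the Euclidean norm). Then the least singular value $s_n(X+M_n)$ satisfies $$\mathbb P\bigl(s_n(X+M_n)\le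 n^{-B}\bigr)\le C\,n^{-A}.$$ -/

import Mathlib

open MeasureTheory ProbabilityTheory Filter Topology

/-- The least singular value `s_n(W)` of an `n × n` matrix `W` over `ℝ` or `ℂ`. Mathlib lists the
singular values in decreasing order starting with the index `0`, so the `n`-th one has index
`n - 1` (only used for `1 ≤ n`). -/
noncomputable def leastSingularValue {𝕜 : Type*} [RCLike 𝕜] {n : ℕ}
    (W : Matrix (Fin n) (Fin n) 𝕜) : ℝ :=
  (Matrix.toEuclideanLin W).singularValues (n - 1)

/-- Real random `n × n` matrices with correlated entries. The pairs `(X_jk, X_kj)`, `j < k`, are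
mutually independent, the diagonal is independent of the off-diagonal entries (nothing is assumed
about the joint law of the diagonal entries), all entries are centred with variance one, and
`E X_jk X_kj = ρ` for `j < k`. -/
structure IsCorrelatedRandomMatrix {Ω : Type*} [MeasurableSpace Ω] (μ : Measure Ω) (ρ : ℝ)
    {n : ℕ} (X : Ω → Matrix (Fin n) (Fin n) ℝ) : Prop where
  measurable : ∀ j k, Measurable (fun ω => X ω j k)
  indep_pairs : iIndepFun
    (fun (p : {p : Fin n × Fin n // p.1 < p.2}) (ω : Ω) =>
      (X ω p.1.1 p.1.2, X ω p.1.2 p.1.1)) μ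
  indep_diag : IndepFun
    (fun (ω : Ω) (j : Fin n) => X ω j j)
    (fun (ω : Ω) (p : {p : Fin n × Fin n // p.1 ≠ p.2}) => X ω p.1.1 p.1.2) μ
  mean_zero : ∀ j k, ∫ ω, X ω j k ∂μ = 0
  variance_one : ∀ j k, ∫ ω, (X ω j k) ^ 2 ∂μ = 1
  correlation : ∀ j k, j < k → ∫ ω, X ω j k * X ω k j ∂μ = ρ

/-- The squares of the entries of `X` are uniformly integrable with modulus `φ`:
`max_{j,k} E |X_jk|² 1{|X_jk| > T} ≤ φ T` for every `T`. -/
def HasSquareUIModulus {Ω : Type*} [MeasurableSpace Ω] (μ : Measure Ω) (φ : ℝ → ℝ)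
    {n : ℕ} (X : Ω → Matrix (Fin n) (Fin n) ℝ) : Prop :=
  ∀ (T : ℝ) (j k : Fin n), ∫ ω in {ω | T < |X ω j k|}, |X ω j k| ^ 2 ∂μ ≤ φ T

-- Write `W = X + M`. A small singular value yields a vector `y` of sup norm 1 with `W y` tiny. Put
-- `m = ⌈n ^ (9/10)⌉`. Three facts force such a `y` to be rare.
--
-- Sparse vectors. If fewer than `m` coordinates of `y` exceed `τ`, rounding produces a nearly null
-- vector in a net of size `n ^ O(m)`. A fixed vector with a large `k`-th coordinate meets a fresh
-- entry `X i k` in every row `i ≠ k`, so it is nearly null with probability exponentially small in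
-- `n` (`measureReal_mulVec_small_le`). Since `m log n = o(n)`, the union bound
-- `measureReal_netEvent_le` wins.
--
-- Averaging. Otherwise at least `m` of the events "some nearly null vector has a large `k`-th
-- coordinate" occur together, and Markov's inequality costs only the factor `n / m` over the bound
-- for a single `k` (`mul_measureReal_le_sum`).
--
-- One coordinate. Freeze everything outside the off-diagonal part of row and column `k`. What is
-- left is a bordered matrix with fixed block `B`, fixed corner `w`, random column `U` and random
-- row `V` (`pi_real_borderedNullEvent_le`). If `B` has a nearly null left vector `z`, then `z ⬝ᵥ U`
-- is small, a linear small ball event with spread coefficients. If not, `B` is invertible and the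
-- Schur complement `w - V B⁻¹ U` is small. Decoupling over a coordinate set `J` of size about `m /
-- 2` (`sq_pi_real_le_of_decoupled`) turns this bilinear form into a linear one whose coefficients
-- include `b = B⁻¹ u` with `u` supported on `J`. As `B b` vanishes off `J`, `b` is a null vector on
-- the rows `Jᶜ`, hence spread.
--
-- The linear events are handled by Erdős' Littlewood–Offord argument and have probability `O(m ^
-- (-1/2))`. Decoupling takes a square root, and `(n / m) * m ^ (-1/4)` is at most `n ^ (-1/8)`. The
-- condition `|ρ| < 1` enters through `isSpreadLaw_of_moments`: no combination of `X j k` and `X k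
-- j` degenerates, so the correlation within pairs is harmless.

-- Sperner's theorem and the Littlewood–Offord inequality.

theorem centralBinom_sq_mul_le (r : ℕ) : r.centralBinom ^ 2 * (2 * r + 1) ≤ 16 ^ r := by
  induction r with
  | zero => simp
  | succ r ih =>
    have h := Nat.succ_mul_centralBinom_succ r
    have h2 : ((r + 1).centralBinom ^ 2 * (2 * (r + 1) + 1)) * (r + 1) ^ 2
        = (r.centralBinom ^ 2 * (2 * r + 1)) * (4 * ((2 * r + 1) * (2 * r + 3))) := by
      calc _ = ((r + 1) * (r + 1).centralBinom) ^ 2 * (2 * r + 3) := by ring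
        _ = _ := by rw [h]; ring
    have h3 : (r.centralBinom ^ 2 * (2 * r + 1)) * (4 * ((2 * r + 1) * (2 * r + 3)))
        ≤ 16 ^ r * (16 * (r + 1) ^ 2) := by
      exact Nat.mul_le_mul ih (by nlinarith)
    refine Nat.le_of_mul_le_mul_right (c := (r + 1) ^ 2) ?_ (by positivity)
    rw [h2]
    refine h3.trans (le_of_eq ?_)
    ring

theorem choose_half_sq_mul_le (k : ℕ) : (k.choose (k / 2)) ^ 2 * (k + 1) ≤ 4 ^ k := by
  rcases Nat.even_or_odd' k with ⟨r, rfl | rfl⟩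
  · have := centralBinom_sq_mul_le r
    rw [Nat.centralBinom_eq_two_mul_choose] at this
    rw [Nat.mul_div_cancel_left r two_pos, pow_mul]
    exact this
  · have h := centralBinom_sq_mul_le (r + 1)
    have h1 : (2 * r + 1) / 2 = r := by omega
    have h2 : (r + 1).centralBinom = 2 * (2 * r + 1).choose r := by
      rw [Nat.centralBinom_eq_two_mul_choose, show 2 * (r + 1) = (2 * r + 1) + 1 by ring,
        Nat.choose_succ_succ', Nat.choose_symm_half]
      ring
    rw [h1]
    rw [h2] at h
    have e : (16 : ℕ) ^ (r + 1) = 4 * 4 ^ (2 * r + 1) := by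
      rw [pow_succ 4 (2 * r), pow_mul]; norm_num; ring
    rw [e] at h
    nlinarith

theorem choose_half_le (k : ℕ) : ((k.choose (k / 2) : ℕ) : ℝ) ≤ 2 ^ k / √(k + 1) := by
  have h := choose_half_sq_mul_le k
  have h' : ((k.choose (k / 2) : ℕ) : ℝ) ^ 2 * (k + 1) ≤ 4 ^ k := by exact_mod_cast h
  rw [le_div_iff₀ (by positivity)]
  refine le_of_sq_le_sq ?_ (by positivity)
  rw [mul_pow, Real.sq_sqrt (by positivity), ← pow_mul, mul_comm k, pow_mul]
  norm_num
  exact h'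

/-- Number of choices between `x j` and `y j` for which the sum falls into a short interval. -/
theorem card_sum_choice_le {ι : Type*} [Fintype ι] [DecidableEq ι] (x y : ι → ℝ) (c t : ℝ)
    (I : Finset ι) (hI : ∀ j ∈ I, 2 * t < |x j - y j|) :
    (Finset.univ.filter fun A : Finset ι =>
        |∑ j, (if j ∈ A then x j else y j) + c| ≤ t).card
      ≤ I.card.choose (I.card / 2) * 2 ^ (Fintype.card ι - I.card) := by
  classical
  set s := Finset.univ.filter fun A : Finset ι =>
        |∑ j, (if j ∈ A then x j else y j) + c| ≤ t with hs
  have hcard : (Iᶜ.powerset).card = 2 ^ (Fintype.card ι - I.card) := by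
    rw [Finset.card_powerset, Finset.card_compl]
  rw [← hcard]
  refine Finset.card_le_mul_card_image_of_maps_to (f := fun A => A ∩ Iᶜ)
    (fun A _ => by simp [Finset.inter_subset_right]) _ (fun b _ => ?_)
  -- Erdős' argument: with the choices outside `I` frozen, `F A` records where the larger of `x j`,
  -- `y j` is taken. Strictly enlarging `F A` raises the sum by more than `2 * t`, so the admissible
  -- sets `F A` form an antichain.
  set F : Finset ι → Finset I := fun A => Finset.univ.filter fun j => (j.1 ∈ A ↔ y j.1 ≤ x j.1)
    with hF
  have hinj : Set.InjOn F (s.filter fun A => A ∩ Iᶜ = b : Finset (Finset ι)) := by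
    intro A hA A' hA' hAA
    simp only [Finset.coe_filter, Set.mem_ofPred_eq] at hA hA'
    ext j
    by_cases hj : j ∈ I
    · have := Finset.ext_iff.1 hAA ⟨j, hj⟩
      simp only [hF, Finset.mem_filter, Finset.mem_univ, true_and] at this
      tauto
    · have := Finset.ext_iff.1 (hA.2.trans hA'.2.symm) j
      simpa [hj] using this
  rw [← Finset.card_image_of_injOn hinj]
  have hfc : Fintype.card I = I.card := Fintype.card_coe I
  rw [← hfc]
  refine IsAntichain.sperner ?_
  intro U hU U' hU' hne hsub
  simp only [Finset.coe_image, Set.mem_image, Finset.coe_filter, Set.mem_ofPred_eq] at hU hU'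
  obtain ⟨A, ⟨hA, hAb⟩, rfl⟩ := hU
  obtain ⟨A', ⟨hA', hAb'⟩, rfl⟩ := hU'
  obtain ⟨j₀, hj₀', hj₀⟩ := Finset.exists_of_ssubset (Finset.ssubset_iff_subset_ne.2 ⟨hsub, hne⟩)
  simp only [hs, Finset.mem_filter, Finset.mem_univ, true_and] at hA hA'
  have hterm : ∀ j, (if j ∈ A then x j else y j) ≤ (if j ∈ A' then x j else y j) := by
    intro j
    by_cases hj : j ∈ I
    · have := @hsub ⟨j, hj⟩
      simp only [hF, Finset.mem_filter, Finset.mem_univ, true_and] at this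
      split_ifs with h1 h2 h2 <;> simp only [h1, h2, true_iff, false_iff, not_le] at this <;>
        first | exact le_rfl | skip
      · by_contra hcon
        exact absurd (this (by linarith)) (by linarith)
      · by_contra hcon
        exact absurd (this (by linarith)) (by linarith)
    · have := Finset.ext_iff.1 (hAb.trans hAb'.symm) j
      simp only [Finset.mem_inter, Finset.mem_compl, hj, not_false_eq_true, and_true] at this
      simp [this]
  have hstrict : 2 * t < (if j₀.1 ∈ A' then x j₀ else y j₀) - (if j₀.1 ∈ A then x j₀ else y j₀) := by
    have hlt := hI j₀ j₀.2
    simp only [hF, Finset.mem_filter, Finset.mem_univ, true_and] at hj₀ hj₀'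
    by_cases h1 : j₀.1 ∈ A <;> by_cases h2 : j₀.1 ∈ A' <;>
      simp only [h1, h2, true_iff, false_iff, not_le, not_lt, if_true, if_false] at hj₀ hj₀' ⊢
    · linarith
    · rw [abs_sub_comm, abs_of_nonneg (by linarith)] at hlt; exact hlt
    · rw [abs_of_nonneg (by linarith)] at hlt; exact hlt
    · linarith
  have hsum : (if j₀.1 ∈ A' then x j₀ else y j₀) - (if j₀.1 ∈ A then x j₀ else y j₀) ≤
      ∑ j, ((if j ∈ A' then x j else y j) - (if j ∈ A then x j else y j)) :=
    Finset.single_le_sum (f := fun j => (if j ∈ A' then x j else y j) - (if j ∈ A then x j else y j))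
      (fun j _ => sub_nonneg.2 (hterm j)) (Finset.mem_univ j₀.1)
  rw [Finset.sum_sub_distrib] at hsum
  have h1 := (abs_le.1 hA).1
  have h2 := (abs_le.1 hA').2
  linarith

theorem card_sum_choice_le_div_sqrt {ι : Type*} [Fintype ι] [DecidableEq ι] (x y : ι → ℝ) (c t : ℝ)
    (I : Finset ι) (hI : ∀ j ∈ I, 2 * t < |x j - y j|) :
    ((Finset.univ.filter fun A : Finset ι =>
        |∑ j, (if j ∈ A then x j else y j) + c| ≤ t).card : ℝ)
      ≤ 2 ^ Fintype.card ι / √(I.card + 1) := by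
  have h := card_sum_choice_le x y c t I hI
  have h2 : I.card ≤ Fintype.card ι := Finset.card_le_univ I
  calc _ ≤ ((I.card.choose (I.card / 2) * 2 ^ (Fintype.card ι - I.card) : ℕ) : ℝ) := by
        exact_mod_cast h
    _ ≤ 2 ^ I.card / √(I.card + 1) * 2 ^ (Fintype.card ι - I.card) := by
        push_cast
        gcongr
        exact choose_half_le _
    _ = _ := by
        rw [div_mul_eq_mul_div, ← pow_add, Nat.add_sub_cancel' h2]

/-- Exchanging coordinates between two independent copies does not change the law. This serves both
the symmetrisation below and the decoupling. -/
theorem measurePreserving_mix {ι E : Type*} [Fintype ι] [DecidableEq ι] [MeasurableSpace E]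
    (ν : ι → Measure E) [∀ i, IsProbabilityMeasure (ν i)] (A : Finset ι) :
    MeasurePreserving (fun (ω : ι → E × E) (j : ι) => if j ∈ A then (ω j).1 else (ω j).2)
      (Measure.pi fun j => (ν j).prod (ν j)) (Measure.pi ν) := by
  have := measurePreserving_pi (fun j => (ν j).prod (ν j)) ν
    (f := fun j (p : E × E) => if j ∈ A then p.1 else p.2) (fun j => by
      by_cases hj : j ∈ A
      · simp only [hj, if_true]; exact measurePreserving_fst
      · simp only [hj, if_false]; exact measurePreserving_snd)
  exact this

/-- A Littlewood–Offord bound for sums of independent variables none of which is concentrated. -/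
theorem pi_real_abs_sum_le {ι E : Type*} [Fintype ι] [MeasurableSpace E]
    (ν : ι → Measure E) [∀ i, IsProbabilityMeasure (ν i)] (f : ι → E → ℝ)
    (hf : ∀ i, Measurable (f i)) (I : Finset ι) (hI : 0 < I.card) {δ t : ℝ} (c : ℝ) (hδ : 0 < δ)
    (h : ∀ j ∈ I, ((ν j).prod (ν j)).real {p | |f j p.1 - f j p.2| ≤ 2 * t} ≤ 1 - δ) :
    (Measure.pi ν).real {ξ | |∑ j, f j (ξ j) + c| ≤ t} ≤ 4 / √(δ * I.card) := by
  classical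
  set π := Measure.pi fun j => (ν j).prod (ν j) with hπ
  set S : Set (ι → E) := {ξ | |∑ j, f j (ξ j) + c| ≤ t} with hS
  have hSm : MeasurableSet S := by
    refine measurableSet_le ?_ measurable_const
    fun_prop
  -- Every mixture has the original law, so the probability equals its average over all `A`. For a
  -- fixed pair of copies this average is a deterministic count, bounded by the Sperner argument.
  set mix : Finset ι → (ι → E × E) → (ι → E) := fun A ω j => if j ∈ A then (ω j).1 else (ω j).2
  have hmix : ∀ A, MeasurePreserving (mix A) π (Measure.pi ν) := fun A => measurePreserving_mix ν A
  set N : ℝ := 2 ^ Fintype.card ι with hN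
  have hNpos : 0 < N := by positivity
  set r : ℝ := δ * I.card / 4 with hr
  have hrpos : 0 < r := by positivity
  -- The product of the `G j` is `exp (-k)`, where `k` counts the coordinates of `I` at which the
  -- two copies are separated. Its expectation plays the role of a Chernoff bound for `k`.
  set G : ι → E × E → ℝ := fun j p =>
    if j ∈ I ∧ 2 * t < |f j p.1 - f j p.2| then Real.exp (-1) else 1 with hG
  have hset : ∀ j, MeasurableSet {p : E × E | 2 * t < |f j p.1 - f j p.2|} := fun j => by
    refine measurableSet_lt measurable_const ?_
    have := hf j
    fun_prop
  have hGm : ∀ j, Measurable (G j) := fun j => by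
    refine Measurable.ite ?_ measurable_const measurable_const
    exact (MeasurableSet.const _).inter (hset j)
  have hG0 : ∀ j p, 0 ≤ G j p := fun j p => by
    simp only [hG]; split_ifs <;> positivity
  have hG1 : ∀ j p, G j p ≤ 1 := fun j p => by
    simp only [hG]; split_ifs <;> simp
  have hGI : ∀ j ∈ I, ∫ p, G j p ∂((ν j).prod (ν j)) ≤ Real.exp (-(δ / 2)) := by
    intro j hj
    have e1 : G j = fun p => 1 - (1 - Real.exp (-1)) *
        Set.indicator {p : E × E | 2 * t < |f j p.1 - f j p.2|} (fun _ => (1 : ℝ)) p := by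
      funext p
      by_cases hp : 2 * t < |f j p.1 - f j p.2|
      · simp [hG, hj, hp]
      · simp [hG, hj, hp]
    have e2 : ∫ p, G j p ∂((ν j).prod (ν j)) = 1 - (1 - Real.exp (-1)) *
        ((ν j).prod (ν j)).real {p : E × E | 2 * t < |f j p.1 - f j p.2|} := by
      rw [e1, integral_sub (integrable_const _)
        (((integrable_const _).indicator (hset j)).const_mul _), integral_const_mul,
        integral_indicator_const _ (hset j)]
      simp
    have e3 : ((ν j).prod (ν j)).real {p : E × E | 2 * t < |f j p.1 - f j p.2|} =
        1 - ((ν j).prod (ν j)).real {p | |f j p.1 - f j p.2| ≤ 2 * t} := by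
      rw [← probReal_compl_eq_one_sub]
      · congr 1; ext p; simp
      · have := (hset j).compl
        convert this using 1
        ext p; simp
    have hexp : Real.exp (-1) ≤ 1 / 2 := by
      have := Real.exp_one_gt_d9
      rw [Real.exp_neg, inv_eq_one_div]
      exact one_div_le_one_div_of_le two_pos (by linarith)
    have h4 := h j hj
    rw [e2, e3]
    have h5 := Real.add_one_le_exp (-(δ / 2))
    nlinarith
  have hGn : ∀ j ∉ I, ∫ p, G j p ∂((ν j).prod (ν j)) = 1 := by
    intro j hj
    simp [hG, hj]
  have hprod : ∫ ω, ∏ j, G j (ω j) ∂π ≤ Real.exp (-(2 * r)) := by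
    rw [hπ, integral_fintype_prod_eq_prod]
    have e : ∏ j, ∫ p, G j p ∂((ν j).prod (ν j)) ≤ ∏ j, (if j ∈ I then Real.exp (-(δ / 2)) else 1) := by
      refine Finset.prod_le_prod (fun j _ => integral_nonneg (hG0 j)) (fun j _ => ?_)
      split_ifs with hj
      · exact hGI j hj
      · exact (hGn j hj).le
    refine e.trans (le_of_eq ?_)
    rw [Finset.prod_ite_mem, Finset.univ_inter, Finset.prod_const, ← Real.exp_nat_mul]
    congr 1
    rw [hr]; ring
  have hcount : ∀ ω, ∑ A : Finset ι, (mix A ⁻¹' S).indicator (fun _ => (1 : ℝ)) ω ≤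
      N * (1 / √r + Real.exp r * ∏ j, G j (ω j)) := by
    intro ω
    set Iω := I.filter fun j => 2 * t < |f j (ω j).1 - f j (ω j).2| with hIω
    have h1 : ∑ A : Finset ι, (mix A ⁻¹' S).indicator (fun _ => (1 : ℝ)) ω ≤
        N / √(Iω.card + 1) := by
      refine le_trans (le_of_eq ?_) (card_sum_choice_le_div_sqrt (fun j => f j (ω j).1)
        (fun j => f j (ω j).2) c t Iω (fun j hj => (Finset.mem_filter.1 hj).2))
      rw [Finset.card_filter]
      push_cast
      refine Finset.sum_congr rfl fun A _ => ?_
      simp only [Set.indicator_apply, Set.mem_preimage, hS, Set.mem_ofPred_eq, mix, apply_ite]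
      split_ifs <;> simp
    have h2 : ∏ j, G j (ω j) = Real.exp (-(Iω.card : ℝ)) := by
      have : ∀ j, G j (ω j) = if j ∈ Iω then Real.exp (-1) else 1 := fun j => by
        simp [hG, hIω]
      simp_rw [this]
      rw [Finset.prod_ite_mem, Finset.univ_inter, Finset.prod_const, ← Real.exp_nat_mul]
      congr 1; ring
    rw [h2, ← Real.exp_add]
    refine h1.trans ?_
    rw [div_eq_mul_one_div]
    refine mul_le_mul_of_nonneg_left ?_ hNpos.le
    -- If `k ≥ r` the first term dominates `1 / √(k + 1)`. If `k < r` the exponential is already at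
    -- least 1.
    by_cases hk : r ≤ Iω.card
    · have : 1 / √((Iω.card : ℝ) + 1) ≤ 1 / √r :=
        one_div_le_one_div_of_le (by positivity) (Real.sqrt_le_sqrt (by linarith))
      have := Real.exp_pos (r + -(Iω.card : ℝ))
      linarith
    · push Not at hk
      have h3 : 1 / √((Iω.card : ℝ) + 1) ≤ 1 := by
        rw [div_le_one (by positivity)]
        exact Real.one_le_sqrt.2 (by linarith [(Nat.cast_nonneg Iω.card : (0 : ℝ) ≤ _)])
      have h4 : 1 ≤ Real.exp (r + -(Iω.card : ℝ)) := Real.one_le_exp (by linarith)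
      have : 0 ≤ 1 / √r := by positivity
      linarith
  have hmain : N * (Measure.pi ν).real S ≤ N * (1 / √r + Real.exp r * Real.exp (-(2 * r))) := by
    have hind : ∀ A : Finset ι, Integrable ((mix A ⁻¹' S).indicator (fun _ => (1 : ℝ))) π :=
      fun A => (integrable_const _).indicator ((hmix A).measurable hSm)
    have hpint : Integrable (fun ω : ι → E × E => ∏ j, G j (ω j)) π := by
      refine Integrable.of_bound (C := 1) ?_ (Eventually.of_forall fun ω => ?_)
      · refine Measurable.aestronglyMeasurable ?_
        refine Finset.measurable_prod _ fun j _ => ?_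
        exact (hGm j).comp (measurable_pi_apply j)
      · rw [Real.norm_of_nonneg (Finset.prod_nonneg fun j _ => hG0 j _)]
        exact Finset.prod_le_one (fun j _ => hG0 j _) (fun j _ => hG1 j _)
    have e1 : N * (Measure.pi ν).real S =
        ∫ ω, ∑ A : Finset ι, (mix A ⁻¹' S).indicator (fun _ => (1 : ℝ)) ω ∂π := by
      rw [integral_finsetSum _ (fun A _ => hind A)]
      have : ∀ A : Finset ι, ∫ ω, (mix A ⁻¹' S).indicator (fun _ => (1 : ℝ)) ω ∂π
          = (Measure.pi ν).real S := by
        intro A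
        rw [integral_indicator_const _ ((hmix A).measurable hSm), smul_eq_mul, mul_one,
          measureReal_def, (hmix A).measure_preimage hSm.nullMeasurableSet, measureReal_def]
      simp [this, hN]
    rw [e1]
    refine (integral_mono (integrable_finsetSum _ fun A _ => hind A) ?_ hcount).trans ?_
    · exact ((integrable_const _).add (hpint.const_mul _)).const_mul _
    · rw [integral_const_mul, integral_add (integrable_const _) (hpint.const_mul _),
        integral_const_mul]
      simp only [integral_const, probReal_univ, one_smul]
      gcongr
  have hfin := le_of_mul_le_mul_left hmain hNpos
  refine hfin.trans ?_
  have h6 : Real.exp r * Real.exp (-(2 * r)) ≤ 1 / √r := by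
    rw [← Real.exp_add, show r + -(2 * r) = -r by ring, Real.exp_neg, inv_eq_one_div]
    refine one_div_le_one_div_of_le (by positivity) ?_
    have := Real.add_one_le_exp r
    refine le_trans ?_ this
    rw [Real.sqrt_le_left (by linarith)]
    nlinarith
  have h7 : √r = √(δ * I.card) / 2 := by
    rw [hr, Real.sqrt_div' _ (by norm_num), show (4 : ℝ) = 2 ^ 2 by norm_num,
      Real.sqrt_sq (by norm_num)]
  have h8 : 0 < √(δ * I.card) := by positivity
  calc _ ≤ 1 / √r + 1 / √r := by linarith
    _ = 4 / √(δ * I.card) := by rw [h7]; field_simp; norm_num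

-- Nondegeneracy of the pairs of correlated entries.

/-- No nonzero real combination of the two coordinates is concentrated: with probability at least
`δ`, two independent samples of `a u + b v` differ by at least `κ * max |a| |b|`. -/
def IsSpreadLaw (κ δ : ℝ) (ν : Measure (ℝ × ℝ)) : Prop :=
  ∀ a b : ℝ, (ν.prod ν).real
    {p | |a * (p.1.1 - p.2.1) + b * (p.1.2 - p.2.2)| < κ * max |a| |b|} ≤ 1 - δ

theorem integral_sub_sq_prod {E : Type*} [MeasurableSpace E] {ν : Measure E}
    [IsProbabilityMeasure ν] {h : E → ℝ} (hh : MemLp h 2 ν) (h0 : ∫ p, h p ∂ν = 0) :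
    Integrable (fun p : E × E => (h p.1 - h p.2) ^ 2) (ν.prod ν) ∧
    ∫ p, (h p.1 - h p.2) ^ 2 ∂(ν.prod ν) = 2 * ∫ p, (h p) ^ 2 ∂ν := by
  have i1 : Integrable h ν := hh.integrable one_le_two
  have i2 : Integrable (fun p => h p ^ 2) ν := hh.integrable_sq
  have j1 : Integrable (fun p : E × E => h p.1 ^ 2 * 1) (ν.prod ν) :=
    i2.mul_prod (integrable_const 1)
  have j2 : Integrable (fun p : E × E => 1 * h p.2 ^ 2) (ν.prod ν) :=
    (integrable_const (1 : ℝ)).mul_prod i2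
  have j3 : Integrable (fun p : E × E => h p.1 * h p.2) (ν.prod ν) := i1.mul_prod i1
  have e : (fun p : E × E => (h p.1 - h p.2) ^ 2) =
      fun p => h p.1 ^ 2 * 1 + 1 * h p.2 ^ 2 - 2 * (h p.1 * h p.2) := by
    funext p; ring
  rw [e]
  have j12 : Integrable (fun p : E × E => h p.1 ^ 2 * 1 + 1 * h p.2 ^ 2) (ν.prod ν) := j1.add j2
  refine ⟨j12.sub (j3.const_mul 2), ?_⟩
  rw [integral_sub j12 (j3.const_mul 2), integral_add j1 j2, integral_const_mul (2 : ℝ),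
    integral_prod_mul (fun p => h p ^ 2) (fun _ => (1 : ℝ)),
    integral_prod_mul (fun _ => (1 : ℝ)) (fun p => h p ^ 2), integral_prod_mul h h, h0]
  simp
  ring

theorem sq_sub_le_tail (T x y : ℝ) :
    (x - y) ^ 2 ≤ 4 * T ^ 2 + 4 * Set.indicator {z : ℝ | T < |z|} (fun z => z ^ 2) x
      + 4 * Set.indicator {z : ℝ | T < |z|} (fun z => z ^ 2) y := by
  have key : ∀ z : ℝ, 0 ≤ Set.indicator {z : ℝ | T < |z|} (fun z => z ^ 2) z ∧
      z ^ 2 ≤ T ^ 2 + Set.indicator {z : ℝ | T < |z|} (fun z => z ^ 2) z := by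
    intro z
    by_cases hz : T < |z|
    · simp only [Set.indicator, Set.mem_ofPred_eq, hz, if_true]
      exact ⟨sq_nonneg z, by nlinarith [sq_nonneg T]⟩
    · simp only [Set.indicator, Set.mem_ofPred_eq, hz, if_false]
      push Not at hz
      refine ⟨le_rfl, ?_⟩
      rw [← sq_abs z]
      nlinarith [abs_nonneg z]
  have hx := key x
  have hy := key y
  have h3 : (x - y) ^ 2 ≤ 4 * max (x ^ 2) (y ^ 2) := by
    rcases le_total (x ^ 2) (y ^ 2) with h | h
    · rw [max_eq_right h]; nlinarith [sq_nonneg (x + y)]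
    · rw [max_eq_left h]; nlinarith [sq_nonneg (x + y)]
  rcases le_total (x ^ 2) (y ^ 2) with h | h
  · rw [max_eq_right h] at h3; linarith [hx.1, hx.2, hy.1, hy.2]
  · rw [max_eq_left h] at h3; linarith [hx.1, hx.2, hy.1, hy.2]

/-- A second moment argument with truncation. Let `θ = 1 - |ρ|`, which bounds the covariance matrix
from below, and let `M = max |a| |b|`. The squared difference of two samples has mean at least `2 θ
M²`. The event of small differences contributes at most `κ² M² = θ M² / 2`, the tails beyond `T`
another `θ M² / 2`, and the rest at most `16 M² T²` times the probability of the complement, which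
is therefore at least `θ / (16 T²)`. -/
theorem isSpreadLaw_of_moments {ν : Measure (ℝ × ℝ)} [IsProbabilityMeasure ν] {ρ T : ℝ}
    (hρ : |ρ| < 1) (hT : 1 ≤ T)
    (hu : MemLp (fun p : ℝ × ℝ => p.1) 2 ν) (hv : MemLp (fun p : ℝ × ℝ => p.2) 2 ν)
    (hu0 : ∫ p, p.1 ∂ν = 0) (hv0 : ∫ p, p.2 ∂ν = 0)
    (hu1 : ∫ p, p.1 ^ 2 ∂ν = 1) (hv1 : ∫ p, p.2 ^ 2 ∂ν = 1)
    (huv : ∫ p, p.1 * p.2 ∂ν = ρ)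
    (hut : ∫ p in {p | T < |p.1|}, p.1 ^ 2 ∂ν ≤ (1 - |ρ|) / 128)
    (hvt : ∫ p in {p | T < |p.2|}, p.2 ^ 2 ∂ν ≤ (1 - |ρ|) / 128) :
    IsSpreadLaw (√((1 - |ρ|) / 2)) ((1 - |ρ|) / (16 * T ^ 2)) ν := by
  intro a b
  set θ := 1 - |ρ| with hθ
  have hθ0 : 0 < θ := by rw [hθ]; linarith
  have hθ1 : θ ≤ 1 := by rw [hθ]; linarith [abs_nonneg ρ]
  set M := max |a| |b| with hM
  have hM0 : 0 ≤ M := (abs_nonneg a).trans (le_max_left _ _)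
  set κ := √(θ / 2) with hκ
  have hκ2 : κ ^ 2 = θ / 2 := Real.sq_sqrt (by positivity)
  have hκ0 : 0 ≤ κ := Real.sqrt_nonneg _
  have hδ1 : θ / (16 * T ^ 2) ≤ 1 := by
    rw [div_le_one (by positivity)]; nlinarith
  rcases hM0.eq_or_lt with hM0' | hMpos
  · have : {p : (ℝ × ℝ) × (ℝ × ℝ) | |a * (p.1.1 - p.2.1) + b * (p.1.2 - p.2.2)| < κ * M} = ∅ := by
      ext p
      simp [← hM0']
    rw [this]
    simpa using hδ1
  set h : ℝ × ℝ → ℝ := fun p => a * p.1 + b * p.2 with hh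
  have hmem : MemLp h 2 ν := (hu.const_mul a).add (hv.const_mul b)
  have iu := hu.integrable one_le_two
  have iv := hv.integrable one_le_two
  have iu2 := hu.integrable_sq
  have iv2 := hv.integrable_sq
  have iuv : Integrable (fun p : ℝ × ℝ => p.1 * p.2) ν := hu.integrable_mul hv
  have hh0 : ∫ p, h p ∂ν = 0 := by
    rw [hh, integral_add (iu.const_mul a) (iv.const_mul b), integral_const_mul, integral_const_mul,
      hu0, hv0]
    simp
  have hh2 : ∫ p, h p ^ 2 ∂ν = a ^ 2 + b ^ 2 + 2 * ρ * (a * b) := by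
    have : (fun p => h p ^ 2) = fun p : ℝ × ℝ =>
        a ^ 2 * p.1 ^ 2 + b ^ 2 * p.2 ^ 2 + (2 * (a * b)) * (p.1 * p.2) := by
      funext p; simp only [hh]; ring
    have i12 : Integrable (fun p : ℝ × ℝ => a ^ 2 * p.1 ^ 2 + b ^ 2 * p.2 ^ 2) ν :=
      (iu2.const_mul _).add (iv2.const_mul _)
    rw [this, integral_add i12 (iuv.const_mul _),
      integral_add (iu2.const_mul _) (iv2.const_mul _), integral_const_mul, integral_const_mul,
      integral_const_mul, hu1, hv1, huv]
    ring
  obtain ⟨hint, hval⟩ := integral_sub_sq_prod hmem hh0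
  have hlow : 2 * θ * M ^ 2 ≤ ∫ p : (ℝ × ℝ) × (ℝ × ℝ), (h p.1 - h p.2) ^ 2 ∂(ν.prod ν) := by
    rw [hval, hh2]
    have h1 : -(|ρ| * (|a| * |b|)) ≤ ρ * (a * b) := by
      rw [← abs_mul, ← abs_mul]; exact neg_abs_le _
    have h2 : M ^ 2 ≤ a ^ 2 + b ^ 2 := by
      rw [hM]
      rcases le_total |a| |b| with h | h
      · rw [max_eq_right h, sq_abs]; nlinarith [sq_nonneg a]
      · rw [max_eq_left h, sq_abs]; nlinarith [sq_nonneg b]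
    have h3 : 2 * (|a| * |b|) ≤ a ^ 2 + b ^ 2 := by
      rw [← sq_abs a, ← sq_abs b]; nlinarith [sq_nonneg (|a| - |b|)]
    have h4 : θ * M ^ 2 ≤ θ * (a ^ 2 + b ^ 2) := by gcongr
    have h5 : |ρ| * (2 * (|a| * |b|)) ≤ |ρ| * (a ^ 2 + b ^ 2) := by gcongr
    have h6 : θ * (a ^ 2 + b ^ 2) = (a ^ 2 + b ^ 2) - |ρ| * (a ^ 2 + b ^ 2) := by rw [hθ]; ring
    linarith
  set A : Set ((ℝ × ℝ) × (ℝ × ℝ)) :=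
    {p | |a * (p.1.1 - p.2.1) + b * (p.1.2 - p.2.2)| < κ * M} with hA
  have hAm : MeasurableSet A := measurableSet_lt (by fun_prop) measurable_const
  set tl : ℝ → ℝ := Set.indicator {z : ℝ | T < |z|} (fun z => z ^ 2) with htl
  have hTm : MeasurableSet {z : ℝ | T < |z|} := measurableSet_lt measurable_const (by fun_prop)
  have htl0 : ∀ z, 0 ≤ tl z := fun z => Set.indicator_nonneg (fun z _ => sq_nonneg z) z
  have htle : ∀ z, tl z ≤ z ^ 2 := fun z => Set.indicator_le_self' (fun z _ => sq_nonneg z) z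
  have htlm : Measurable tl := (by fun_prop : Measurable fun z : ℝ => z ^ 2).indicator hTm
  have itu : Integrable (fun p : ℝ × ℝ => tl p.1) ν := by
    refine iu2.mono' (htlm.comp measurable_fst).aestronglyMeasurable
      (Eventually.of_forall fun p => ?_)
    rw [Real.norm_of_nonneg (htl0 _)]; exact htle _
  have itv : Integrable (fun p : ℝ × ℝ => tl p.2) ν := by
    refine iv2.mono' (htlm.comp measurable_snd).aestronglyMeasurable
      (Eventually.of_forall fun p => ?_)
    rw [Real.norm_of_nonneg (htl0 _)]; exact htle _
  set g : ℝ × ℝ → ℝ := fun p => tl p.1 + tl p.2 with hg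
  have ig : Integrable g ν := itu.add itv
  have hgv : ∫ p, g p ∂ν ≤ θ / 64 := by
    rw [hg, integral_add itu itv]
    have e1 : ∫ p : ℝ × ℝ, tl p.1 ∂ν = ∫ p in {p : ℝ × ℝ | T < |p.1|}, p.1 ^ 2 ∂ν := by
      have hTv : MeasurableSet {p : ℝ × ℝ | T < |p.1|} := measurable_fst hTm
      rw [← integral_indicator hTv]
      rfl
    have e2 : ∫ p : ℝ × ℝ, tl p.2 ∂ν = ∫ p in {p : ℝ × ℝ | T < |p.2|}, p.2 ^ 2 ∂ν := by
      have hTv : MeasurableSet {p : ℝ × ℝ | T < |p.2|} := measurable_snd hTm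
      rw [← integral_indicator hTv]
      rfl
    rw [e1, e2]; linarith
  have hpt : ∀ p : (ℝ × ℝ) × (ℝ × ℝ), (h p.1 - h p.2) ^ 2 ≤
      κ ^ 2 * M ^ 2 + (16 * M ^ 2 * T ^ 2) * Aᶜ.indicator (fun _ => (1 : ℝ)) p
        + (16 * M ^ 2) * (g p.1 * 1 + 1 * g p.2) := by
    intro p
    have hgn : 0 ≤ (16 * M ^ 2) * (g p.1 * 1 + 1 * g p.2) := by
      simp only [hg]
      have := htl0 p.1.1; have := htl0 p.1.2; have := htl0 p.2.1; have := htl0 p.2.2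
      positivity
    have hd : h p.1 - h p.2 = a * (p.1.1 - p.2.1) + b * (p.1.2 - p.2.2) := by
      simp only [hh]; ring
    by_cases hp : p ∈ A
    · have h1 : Aᶜ.indicator (fun _ => (1 : ℝ)) p = 0 := by simp [hp]
      rw [h1, hd, ← sq_abs]
      have hp' : |a * (p.1.1 - p.2.1) + b * (p.1.2 - p.2.2)| < κ * M := hp
      have : |a * (p.1.1 - p.2.1) + b * (p.1.2 - p.2.2)| ^ 2 ≤ (κ * M) ^ 2 := by
        gcongr
      rw [mul_pow] at this
      linarith
    · have h1 : Aᶜ.indicator (fun _ => (1 : ℝ)) p = 1 := by simp [hp]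
      rw [h1, hd]
      have ha : a ^ 2 ≤ M ^ 2 := by rw [← sq_abs]; gcongr; exact le_max_left _ _
      have hb : b ^ 2 ≤ M ^ 2 := by rw [← sq_abs]; gcongr; exact le_max_right _ _
      have s1 := sq_sub_le_tail T p.1.1 p.2.1
      have s2 := sq_sub_le_tail T p.1.2 p.2.2
      rw [← htl] at s1 s2
      have t1 := add_sq_le (a := a * (p.1.1 - p.2.1)) (b := b * (p.1.2 - p.2.2))
      rw [mul_pow, mul_pow] at t1
      have t2 : a ^ 2 * (p.1.1 - p.2.1) ^ 2 ≤ M ^ 2 * (4 * T ^ 2 + 4 * tl p.1.1 + 4 * tl p.2.1) :=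
        mul_le_mul ha s1 (sq_nonneg _) (sq_nonneg _)
      have t3 : b ^ 2 * (p.1.2 - p.2.2) ^ 2 ≤ M ^ 2 * (4 * T ^ 2 + 4 * tl p.1.2 + 4 * tl p.2.2) :=
        mul_le_mul hb s2 (sq_nonneg _) (sq_nonneg _)
      have t4 : 0 ≤ κ ^ 2 * M ^ 2 := by positivity
      have t5 : 0 ≤ M ^ 2 * (tl p.1.1 + tl p.1.2 + tl p.2.1 + tl p.2.2) := by
        have := htl0 p.1.1; have := htl0 p.1.2; have := htl0 p.2.1; have := htl0 p.2.2
        positivity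
      simp only [hg]
      linarith
  have ic1 : Integrable (fun p : (ℝ × ℝ) × (ℝ × ℝ) => g p.1 * 1) (ν.prod ν) :=
    ig.mul_prod (integrable_const 1)
  have ic2 : Integrable (fun p : (ℝ × ℝ) × (ℝ × ℝ) => 1 * g p.2) (ν.prod ν) :=
    (integrable_const (1 : ℝ)).mul_prod ig
  have ic3 : Integrable (Aᶜ.indicator (fun _ => (1 : ℝ))) (ν.prod ν) :=
    (integrable_const _).indicator hAm.compl
  have hup := integral_mono hint (((integrable_const (κ ^ 2 * M ^ 2)).add
    (ic3.const_mul (16 * M ^ 2 * T ^ 2))).add ((ic1.add ic2).const_mul (16 * M ^ 2))) hpt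
  have hcalc : ∫ p, (κ ^ 2 * M ^ 2 + (16 * M ^ 2 * T ^ 2) * Aᶜ.indicator (fun _ => (1 : ℝ)) p
        + (16 * M ^ 2) * (g p.1 * 1 + 1 * g p.2)) ∂(ν.prod ν) =
      κ ^ 2 * M ^ 2 + (16 * M ^ 2 * T ^ 2) * (1 - (ν.prod ν).real A)
        + (16 * M ^ 2) * (2 * ∫ p, g p ∂ν) := by
    have k1 : Integrable (fun p => κ ^ 2 * M ^ 2 + (16 * M ^ 2 * T ^ 2) *
        Aᶜ.indicator (fun _ => (1 : ℝ)) p) (ν.prod ν) := (integrable_const _).add (ic3.const_mul _)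
    have k2 : Integrable (fun p : (ℝ × ℝ) × (ℝ × ℝ) => (16 * M ^ 2) * (g p.1 * 1 + 1 * g p.2))
        (ν.prod ν) := (ic1.add ic2).const_mul _
    rw [integral_add k1 k2,
      integral_add (integrable_const _) (ic3.const_mul _),
      integral_const_mul (16 * M ^ 2 * T ^ 2), integral_const_mul (16 * M ^ 2),
      integral_add ic1 ic2, integral_prod_mul g (fun _ => (1 : ℝ)),
      integral_prod_mul (fun _ => (1 : ℝ)) g, integral_indicator_const _ hAm.compl,
      probReal_compl_eq_one_sub hAm]
    simp only [integral_const, probReal_univ, smul_eq_mul, mul_one, one_mul]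
    ring
  have hfinal := hlow.trans (hup.trans (le_of_eq hcalc))
  rw [hκ2] at hfinal
  have hM2 : 0 < M ^ 2 := by positivity
  have hdiv : 2 * θ ≤ θ / 2 + 16 * T ^ 2 * (1 - (ν.prod ν).real A) + 16 * (2 * ∫ p, g p ∂ν) := by
    refine le_of_mul_le_mul_right ?_ hM2
    linarith
  have : θ ≤ 16 * T ^ 2 * (1 - (ν.prod ν).real A) := by linarith
  have : θ / (16 * T ^ 2) ≤ 1 - (ν.prod ν).real A := by
    rw [div_le_iff₀ (by positivity)]; linarith
  linarith

-- Small ball estimates for linear forms in independent pairs.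

section
variable {𝕜 : Type*} [RCLike 𝕜]

/-- Two independent samples in the ball have first coordinates closer than `κ`, so the squared
probability is at most `1 - δ`. Then `√(1 - δ) ≤ 1 - δ / 2`. -/
theorem IsSpreadLaw.measureReal_norm_le {κ δ : ℝ} {ν : Measure (ℝ × ℝ)} [IsProbabilityMeasure ν]
    (hν : IsSpreadLaw κ δ ν) (a c : 𝕜) {t : ℝ} (ht : 2 * t < κ * ‖a‖) :
    ν.real {p | ‖(p.1 : 𝕜) * a + c‖ ≤ t} ≤ 1 - δ / 2 := by
  set A : Set (ℝ × ℝ) := {p | ‖(p.1 : 𝕜) * a + c‖ ≤ t} with hA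
  have h1 : (ν.prod ν).real (A ×ˢ A) ≤ 1 - δ := by
    refine le_trans (measureReal_mono ?_) (hν 1 0)
    rintro ⟨p, q⟩ ⟨hp, hq⟩
    have hp' : ‖(p.1 : 𝕜) * a + c‖ ≤ t := hp
    have hq' : ‖(q.1 : 𝕜) * a + c‖ ≤ t := hq
    have h2 : ‖((p.1 - q.1 : ℝ) : 𝕜) * a‖ ≤ 2 * t := by
      have : ((p.1 - q.1 : ℝ) : 𝕜) * a = ((p.1 : 𝕜) * a + c) - ((q.1 : 𝕜) * a + c) := by
        push_cast; ring
      rw [this]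
      exact (norm_sub_le _ _).trans (by linarith)
    rw [norm_mul, RCLike.norm_ofReal] at h2
    have h3 : |p.1 - q.1| * ‖a‖ < κ * ‖a‖ := h2.trans_lt ht
    have h4 : |p.1 - q.1| < κ := lt_of_mul_lt_mul_right h3 (norm_nonneg _)
    simpa using h4
  rw [measureReal_prod_prod] at h1
  have h0 : 0 ≤ ν.real A := measureReal_nonneg
  nlinarith [sq_nonneg (ν.real A - 1), sq_nonneg (ν.real A - (1 - δ / 2))]

/-- A Littlewood–Offord bound for linear forms in independent pairs. -/
theorem IsSpreadLaw.pi_real_norm_sum_le {ι : Type*} [Fintype ι] {κ δ : ℝ} (hδ : 0 < δ)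
    (hκ : 0 < κ) {ν : ι → Measure (ℝ × ℝ)} [∀ i, IsProbabilityMeasure (ν i)]
    (hν : ∀ i, IsSpreadLaw κ δ (ν i)) (a b : ι → 𝕜) (c : 𝕜) {t τ : ℝ} (I : Finset ι)
    (hI : 0 < I.card) (hab : ∀ i ∈ I, τ ≤ max ‖a i‖ ‖b i‖) (ht : 4 * t < κ * τ) :
    (Measure.pi ν).real {ξ | ‖∑ i, ((ξ i).1 * a i + (ξ i).2 * b i) + c‖ ≤ t}
      ≤ 8 / √(δ * I.card) := by
  classical
  have real_case : ∀ (α β : ι → ℝ) (γ : ℝ) (I' : Finset ι), I.card ≤ 2 * I'.card →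
      (∀ i ∈ I', τ / 2 ≤ max |α i| |β i|) →
      (Measure.pi ν).real {ξ | |∑ i, ((ξ i).1 * α i + (ξ i).2 * β i) + γ| ≤ t}
      ≤ 8 / √(δ * I.card) := by
    intro α β γ I' hI' hαβ
    have hI'0 : 0 < I'.card := by omega
    refine (pi_real_abs_sum_le ν (fun i (p : ℝ × ℝ) => p.1 * α i + p.2 * β i)
      (fun i => by fun_prop) I' hI'0 γ hδ (t := t) ?_).trans ?_
    · intro j hj
      refine le_trans (measureReal_mono ?_) (hν j (α j) (β j))
      intro p hp
      have hp' : |p.1.1 * α j + p.1.2 * β j - (p.2.1 * α j + p.2.2 * β j)| ≤ 2 * t := hp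
      have h1 : p.1.1 * α j + p.1.2 * β j - (p.2.1 * α j + p.2.2 * β j) =
        α j * (p.1.1 - p.2.1) + β j * (p.1.2 - p.2.2) := by ring
      rw [h1] at hp'
      have h2 : κ * (τ / 2) ≤ κ * max |α j| |β j| := by gcongr; exact hαβ j hj
      exact hp'.trans_lt (by linarith)
    · have h1 : (I.card : ℝ) ≤ 2 * I'.card := by exact_mod_cast hI'
      have h2 : √(δ * I.card) ≤ 2 * √(δ * I'.card) := by
        rw [Real.sqrt_le_iff, mul_pow, Real.sq_sqrt (by positivity)]
        refine ⟨by positivity, ?_⟩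
        nlinarith [(Nat.cast_nonneg I'.card : (0 : ℝ) ≤ _)]
      have hp : 0 < √(δ * (I.card : ℝ)) := by positivity
      have hp' : 0 < √(δ * (I'.card : ℝ)) := by positivity
      rw [div_le_div_iff₀ hp' hp]
      linarith
  -- A scalar of norm at least `τ` has real or imaginary part at least `τ / 2`, so one of the two
  -- parts keeps half of `I`. Taking that part of the sum reduces to real coefficients.
  set I₁ := I.filter fun i => τ / 2 ≤ max |RCLike.re (a i)| |RCLike.re (b i)| with hI₁
  set I₂ := I.filter fun i => τ / 2 ≤ max |RCLike.im (a i)| |RCLike.im (b i)| with hI₂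
  have hcov : I ⊆ I₁ ∪ I₂ := by
    intro i hi
    have h1 := hab i hi
    simp only [hI₁, hI₂, Finset.mem_union, Finset.mem_filter, hi, true_and]
    have hz : ∀ z : 𝕜, τ ≤ ‖z‖ → τ / 2 ≤ |RCLike.re z| ∨ τ / 2 ≤ |RCLike.im z| := by
      intro z hz
      by_contra! hcon
      have h1 : ‖z‖ ≤ |RCLike.re z| + |RCLike.im z| := by
        refine le_of_sq_le_sq ?_ (by positivity)
        rw [RCLike.norm_sq_eq_def, ← abs_mul_abs_self (RCLike.re z),
          ← abs_mul_abs_self (RCLike.im z)]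
        nlinarith [mul_nonneg (abs_nonneg (RCLike.re z)) (abs_nonneg (RCLike.im z))]
      linarith
    rcases le_max_iff.1 h1 with h | h
    · rcases hz _ h with h' | h'
      · exact Or.inl (h'.trans (le_max_left _ _))
      · exact Or.inr (h'.trans (le_max_left _ _))
    · rcases hz _ h with h' | h'
      · exact Or.inl (h'.trans (le_max_right _ _))
      · exact Or.inr (h'.trans (le_max_right _ _))
  have hle : I.card ≤ I₁.card + I₂.card :=
    (Finset.card_le_card hcov).trans (Finset.card_union_le _ _)
  rcases (by omega : I.card ≤ 2 * I₁.card ∨ I.card ≤ 2 * I₂.card) with h | h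
  · refine le_trans (measureReal_mono ?_) (real_case (fun i => RCLike.re (a i))
      (fun i => RCLike.re (b i)) (RCLike.re c) I₁ h (fun i hi => (Finset.mem_filter.1 hi).2))
    intro ξ hξ
    have h1 := (RCLike.abs_re_le_norm _).trans (show _ ≤ t from hξ)
    simpa [map_add, map_sum, RCLike.re_ofReal_mul] using h1
  · refine le_trans (measureReal_mono ?_) (real_case (fun i => RCLike.im (a i))
      (fun i => RCLike.im (b i)) (RCLike.im c) I₂ h (fun i hi => (Finset.mem_filter.1 hi).2))
    intro ξ hξ
    have h1 := (RCLike.abs_im_le_norm _).trans (show _ ≤ t from hξ)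
    simpa [map_add, map_sum, RCLike.im_ofReal_mul] using h1

end

-- Independence of one row and column from the rest of the matrix.

theorem IndepFun.prodMk_left_of_prodMk_right {Ω α β γ : Type*} [MeasurableSpace Ω]
    [MeasurableSpace α] [MeasurableSpace β] [MeasurableSpace γ] {μ : Measure Ω}
    [IsProbabilityMeasure μ] {f : Ω → α} {g : Ω → β} {h : Ω → γ} (hf : Measurable f)
    (hg : Measurable g) (hh : Measurable h) (h1 : IndepFun f (fun ω => (g ω, h ω)) μ)
    (h2 : IndepFun g h μ) : IndepFun (fun ω => (f ω, g ω)) h μ := by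
  have := Measure.isProbabilityMeasure_map (μ := μ) hf.aemeasurable
  have := Measure.isProbabilityMeasure_map (μ := μ) hg.aemeasurable
  have := Measure.isProbabilityMeasure_map (μ := μ) hh.aemeasurable
  have h3 : IndepFun f g μ := h1.comp measurable_id measurable_fst
  rw [indepFun_iff_map_prod_eq_prod_map_map (hf.prodMk hg).aemeasurable hh.aemeasurable]
  rw [indepFun_iff_map_prod_eq_prod_map_map hf.aemeasurable (hg.prodMk hh).aemeasurable,
    h2.map_prod_eq_prod_map_map hg.aemeasurable hh.aemeasurable] at h1
  rw [h3.map_prod_eq_prod_map_map hf.aemeasurable hg.aemeasurable]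
  apply MeasurableEquiv.prodAssoc.map_measurableEquiv_injective
  rw [Measure.prodAssoc_prod, ← h1,
    Measure.map_map MeasurableEquiv.prodAssoc.measurable ((hf.prodMk hg).prodMk hh)]
  rfl

/-- The pairs formed by the off-diagonal entries of the `k`-th column and the `k`-th row. -/
def crossPart {n : ℕ} (k : Fin n) (X : Fin n → Fin n → ℝ) : {j // j ≠ k} → ℝ × ℝ :=
  fun j => (X j k, X k j)

/-- The array with the off-diagonal entries of the `k`-th row and column replaced by `0`. -/
def offCross {n : ℕ} (k : Fin n) (X : Fin n → Fin n → ℝ) : Fin n → Fin n → ℝ :=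
  fun i j => if i ≠ j ∧ (i = k ∨ j = k) then 0 else X i j

/-- Insert off-diagonal entries into the `k`-th row and column. -/
def ofCross {n : ℕ} (k : Fin n) (Z : Fin n → Fin n → ℝ) (ξ : {j // j ≠ k} → ℝ × ℝ) :
    Fin n → Fin n → ℝ :=
  fun i j => if hi : i = k then (if hj : j = k then Z i j else (ξ ⟨j, hj⟩).2)
    else (if j = k then (ξ ⟨i, hi⟩).1 else Z i j)

theorem ofCross_offCross {n : ℕ} (k : Fin n) (X : Fin n → Fin n → ℝ) :
    ofCross k (offCross k X) (crossPart k X) = X := by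
  funext i j
  by_cases hi : i = k <;> by_cases hj : j = k <;> simp [ofCross, offCross, crossPart, hi, hj]

theorem measurable_ofCross {n : ℕ} (k : Fin n) :
    Measurable fun p : (Fin n → Fin n → ℝ) × ({j // j ≠ k} → ℝ × ℝ) => ofCross k p.1 p.2 := by
  refine measurable_pi_lambda _ fun i => measurable_pi_lambda _ fun j => ?_
  by_cases hi : i = k <;> by_cases hj : j = k <;> simp only [ofCross, hi, hj] <;> simp <;> fun_prop

section
variable {Ω : Type*} [MeasurableSpace Ω] {μ : Measure Ω} {ρ : ℝ} {n : ℕ}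
  {X : Ω → Matrix (Fin n) (Fin n) ℝ}

theorem IsCorrelatedRandomMatrix.measurable_crossPart (hX : IsCorrelatedRandomMatrix μ ρ X)
    (k : Fin n) : Measurable fun ω => crossPart k (X ω) :=
  measurable_pi_lambda _ fun _ => (hX.measurable _ _).prodMk (hX.measurable _ _)

theorem IsCorrelatedRandomMatrix.measurable_offCross (hX : IsCorrelatedRandomMatrix μ ρ X)
    (k : Fin n) : Measurable fun ω => offCross k (X ω) := by
  refine measurable_pi_lambda _ fun i => measurable_pi_lambda _ fun j => ?_
  simp only [offCross]
  split_ifs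
  · exact measurable_const
  · exact hX.measurable _ _

theorem IsCorrelatedRandomMatrix.iIndepFun_cross (hX : IsCorrelatedRandomMatrix μ ρ X)
    (k : Fin n) :
    iIndepFun (fun (j : {j // j ≠ k}) (ω : Ω) => (X ω j k, X ω k j)) μ := by
  classical
  let g : {j // j ≠ k} → {p : Fin n × Fin n // p.1 < p.2} := fun j =>
    if h : j.1 < k then ⟨(j.1, k), h⟩ else ⟨(k, j.1), lt_of_le_of_ne (not_lt.1 h) j.2.symm⟩
  have hg : Function.Injective g := by
    intro a b hab
    have ha := a.2
    have hb := b.2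
    have := congrArg Subtype.val hab
    simp only [g] at this
    ext
    split_ifs at this <;> simp only [Prod.mk.injEq] at this <;> grind
  have h1 := hX.indep_pairs.precomp hg
  have h2 := h1.comp (fun j => if j.1 < k then id else Prod.swap) (fun j => by
    split_ifs
    · exact measurable_id
    · exact measurable_swap)
  convert! h2 using 1
  funext j ω
  by_cases h : j.1 < k <;> simp [g, h]

/-- The diagonal entries may depend on each other, so the whole diagonal, including the entry at
`k`, stays on the frozen side. The proof regroups three blocks: the diagonal, the pairs avoiding
`k`, and the pairs meeting `k`. -/
theorem IsCorrelatedRandomMatrix.indepFun_offCross [IsProbabilityMeasure μ]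
    (hX : IsCorrelatedRandomMatrix μ ρ X)
    (k : Fin n) : IndepFun (fun ω => offCross k (X ω)) (fun ω => crossPart k (X ω)) μ := by
  classical
  set P : {p : Fin n × Fin n // p.1 < p.2} → Ω → ℝ × ℝ :=
    fun p ω => (X ω p.1.1 p.1.2, X ω p.1.2 p.1.1) with hP
  have hPm : ∀ p, Measurable (P p) := fun p => (hX.measurable _ _).prodMk (hX.measurable _ _)
  set S₁ : Finset {p : Fin n × Fin n // p.1 < p.2} :=
    Finset.univ.filter fun p => p.1.1 = k ∨ p.1.2 = k with hS₁
  set S₂ : Finset {p : Fin n × Fin n // p.1 < p.2} :=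
    Finset.univ.filter fun p => ¬(p.1.1 = k ∨ p.1.2 = k) with hS₂
  have hdisj : Disjoint S₂ S₁ := (Finset.disjoint_filter_filter_not _ _ _).symm
  have h21 := hX.indep_pairs.indepFun_finset S₂ S₁ hdisj hPm
  have hD : IndepFun (fun (ω : Ω) (j : Fin n) => X ω j j)
      (fun ω => ((fun p : S₂ => P p ω), (fun p : S₁ => P p ω))) μ := by
    have := hX.indep_diag.comp (φ := id) (ψ := fun (f : {p : Fin n × Fin n // p.1 ≠ p.2} → ℝ) =>
      ((fun p : S₂ => (f ⟨(p.1.1.1, p.1.1.2), p.1.2.ne⟩, f ⟨(p.1.1.2, p.1.1.1), p.1.2.ne'⟩)),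
      (fun p : S₁ => (f ⟨(p.1.1.1, p.1.1.2), p.1.2.ne⟩, f ⟨(p.1.1.2, p.1.1.1), p.1.2.ne'⟩))))
      measurable_id (by fun_prop)
    exact this
  have hDm : Measurable (fun (ω : Ω) (j : Fin n) => X ω j j) :=
    measurable_pi_lambda _ fun j => hX.measurable j j
  have h3 := IndepFun.prodMk_left_of_prodMk_right hDm
    (measurable_pi_lambda _ fun p : S₂ => hPm p) (measurable_pi_lambda _ fun p : S₁ => hPm p) hD h21
  have hmem₂ : ∀ i j : Fin n, ∀ h : i < j, i ≠ k → j ≠ k →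
      (⟨(i, j), h⟩ : {p : Fin n × Fin n // p.1 < p.2}) ∈ S₂ := fun i j h hi hj => by
    simp [hS₂, hi, hj]
  have hmem₁ : ∀ i j : Fin n, ∀ h : i < j, (i = k ∨ j = k) →
      (⟨(i, j), h⟩ : {p : Fin n × Fin n // p.1 < p.2}) ∈ S₁ := fun i j h hi => by
    simpa [hS₁] using hi
  let φ : (Fin n → ℝ) × (S₂ → ℝ × ℝ) → Fin n → Fin n → ℝ := fun q i j =>
    if h0 : i = j then q.1 i else
    if hk : i = k ∨ j = k then 0 else
    if h : i < j then (q.2 ⟨⟨(i, j), h⟩, hmem₂ i j h (by tauto) (by tauto)⟩).1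
    else (q.2 ⟨⟨(j, i), lt_of_le_of_ne (not_lt.1 h) (Ne.symm h0)⟩,
      hmem₂ j i _ (by tauto) (by tauto)⟩).2
  let ψ : (S₁ → ℝ × ℝ) → {j // j ≠ k} → ℝ × ℝ := fun q j =>
    if h : j.1 < k then q ⟨⟨(j.1, k), h⟩, hmem₁ _ _ h (Or.inr rfl)⟩
    else (q ⟨⟨(k, j.1), lt_of_le_of_ne (not_lt.1 h) j.2.symm⟩, hmem₁ _ _ _ (Or.inl rfl)⟩).swap
  have hφ : Measurable φ := by
    refine measurable_pi_lambda _ fun i => measurable_pi_lambda _ fun j => ?_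
    simp only [φ]
    split_ifs <;> fun_prop
  have hψ : Measurable ψ := by
    refine measurable_pi_lambda _ fun j => ?_
    simp only [ψ]
    split_ifs
    · fun_prop
    · exact measurable_swap.comp (measurable_pi_apply _)
  have h4 := h3.comp hφ hψ
  convert! h4 using 1
  · funext ω i j
    by_cases h0 : i = j
    · simp [offCross, φ, h0]
    · by_cases hk : i = k ∨ j = k
      · simp [offCross, φ, h0, hk]
      · by_cases h : i < j <;> simp [offCross, φ, h0, hk, h]
  · funext ω j
    by_cases h : j.1 < k <;> simp [crossPart, ψ, h]

theorem IsCorrelatedRandomMatrix.map_offCross_crossPart [IsProbabilityMeasure μ]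
    (hX : IsCorrelatedRandomMatrix μ ρ X)
    (k : Fin n) :
    μ.map (fun ω => (offCross k (X ω), crossPart k (X ω))) =
      (μ.map fun ω => offCross k (X ω)).prod
        (Measure.pi fun j : {j // j ≠ k} => μ.map fun ω => (X ω j k, X ω k j)) := by
  rw [(hX.indepFun_offCross k).map_prod_eq_prod_map_map (hX.measurable_offCross k).aemeasurable
    (hX.measurable_crossPart k).aemeasurable]
  congr 1
  exact (iIndepFun_iff_map_fun_eq_pi_map fun j =>
    ((hX.measurable _ _).prodMk (hX.measurable _ _)).aemeasurable).1 (hX.iIndepFun_cross k)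

/-- Conditioning on everything outside the `k`-th row and column. -/
theorem IsCorrelatedRandomMatrix.measureReal_le_of_sections [IsProbabilityMeasure μ]
    (hX : IsCorrelatedRandomMatrix μ ρ X)
    (k : Fin n) {S Bad : Set (Fin n → Fin n → ℝ)} (hS : MeasurableSet S) (hBad : MeasurableSet Bad)
    {q : ℝ} (hq : 0 ≤ q)
    (h : ∀ Z ∉ Bad, (Measure.pi fun j : {j // j ≠ k} => μ.map fun ω => (X ω j k, X ω k j)).real
      {ξ | ofCross k Z ξ ∈ S} ≤ q) :
    μ.real {ω | (fun i j => X ω i j) ∈ S} ≤ μ.real {ω | offCross k (X ω) ∈ Bad} + q := by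
  have hprob : ∀ j : {j // j ≠ k}, IsProbabilityMeasure (μ.map fun ω => (X ω j k, X ω k j)) :=
    fun j => Measure.isProbabilityMeasure_map
      ((hX.measurable _ _).prodMk (hX.measurable _ _)).aemeasurable
  set π := Measure.pi fun j : {j // j ≠ k} => μ.map fun ω => (X ω j k, X ω k j) with hπ
  have hZm := hX.measurable_offCross k
  have hpre : MeasurableSet {p : (Fin n → Fin n → ℝ) × ({j // j ≠ k} → ℝ × ℝ) |
      ofCross k p.1 p.2 ∈ S} := measurable_ofCross k hS
  have h1 : μ {ω | (fun i j => X ω i j) ∈ S} ≤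
      μ {ω | offCross k (X ω) ∈ Bad} + ENNReal.ofReal q := by
    calc μ {ω | (fun i j => X ω i j) ∈ S}
        = μ.map (fun ω => (offCross k (X ω), crossPart k (X ω)))
          {p | ofCross k p.1 p.2 ∈ S} := by
          rw [Measure.map_apply (hZm.prodMk (hX.measurable_crossPart k)) hpre]
          congr 1
          ext ω
          simp only [Set.mem_ofPred_eq, Set.mem_preimage]
          have e : ofCross k (offCross k (X ω)) (crossPart k (X ω)) = fun i j => X ω i j :=
            ofCross_offCross k (X ω)
          rw [e]
      _ = ∫⁻ Z, π {ξ | ofCross k Z ξ ∈ S} ∂(μ.map fun ω => offCross k (X ω)) := by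
          rw [hX.map_offCross_crossPart k, Measure.prod_apply hpre]
          rfl
      _ ≤ ∫⁻ Z, (Bad.indicator 1 Z + ENNReal.ofReal q) ∂(μ.map fun ω => offCross k (X ω)) := by
          refine lintegral_mono fun Z => ?_
          by_cases hZ : Z ∈ Bad
          · simp only [hZ, Set.indicator_of_mem, Pi.one_apply]
            exact prob_le_one.trans le_self_add
          · have := h Z hZ
            rw [measureReal_def] at this
            have h2 : π {ξ | ofCross k Z ξ ∈ S} ≤ ENNReal.ofReal q :=
              (ENNReal.le_ofReal_iff_toReal_le (measure_ne_top _ _) hq).2 this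
            exact h2.trans le_add_self
      _ = _ := by
          have := Measure.isProbabilityMeasure_map (μ := μ) hZm.aemeasurable
          rw [lintegral_add_left (measurable_one.indicator hBad), lintegral_indicator_one hBad,
            Measure.map_apply hZm hBad]
          simp
          rfl
  have h2 := ENNReal.toReal_mono (by finiteness) h1
  rwa [ENNReal.toReal_add (by finiteness) (by finiteness), ENNReal.toReal_ofReal hq] at h2

theorem IsCorrelatedRandomMatrix.transpose (hX : IsCorrelatedRandomMatrix μ ρ X) :
    IsCorrelatedRandomMatrix μ ρ (fun ω => (X ω).transpose) where
  measurable j k := hX.measurable k j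
  indep_pairs := by
    have := hX.indep_pairs.comp (fun _ => Prod.swap) (fun _ => measurable_swap)
    exact this
  indep_diag := by
    have := hX.indep_diag.comp (φ := id)
      (ψ := fun (f : {p : Fin n × Fin n // p.1 ≠ p.2} → ℝ)
        (p : {p : Fin n × Fin n // p.1 ≠ p.2}) => f ⟨(p.1.2, p.1.1), p.2.symm⟩)
      measurable_id (by fun_prop)
    exact this
  mean_zero j k := hX.mean_zero k j
  variance_one j k := hX.variance_one k j
  correlation j k h := by
    rw [← hX.correlation j k h]
    congr with ω
    simp [mul_comm]

theorem IsCorrelatedRandomMatrix.integrable_sq (hX : IsCorrelatedRandomMatrix μ ρ X)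
    (j k : Fin n) : Integrable (fun ω => X ω j k ^ 2) μ := by
  by_contra h
  have := hX.variance_one j k
  -- The integral of a non-integrable function is 0 by convention, so variance one forces
  -- integrability.
  rw [integral_undef h] at this
  exact zero_ne_one this

theorem IsCorrelatedRandomMatrix.isSpreadLaw [IsProbabilityMeasure μ]
    (hX : IsCorrelatedRandomMatrix μ ρ X) {φ : ℝ → ℝ}
    (hφ : HasSquareUIModulus μ φ X) (hρ : |ρ| < 1) {T : ℝ} (hT : 1 ≤ T)
    (hφT : φ T ≤ (1 - |ρ|) / 128) {j k : Fin n} (hjk : j ≠ k) :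
    IsSpreadLaw (√((1 - |ρ|) / 2)) ((1 - |ρ|) / (16 * T ^ 2))
      (μ.map fun ω => (X ω j k, X ω k j)) := by
  have hm : Measurable fun ω => (X ω j k, X ω k j) := (hX.measurable _ _).prodMk (hX.measurable _ _)
  have := Measure.isProbabilityMeasure_map (μ := μ) hm.aemeasurable
  have hmem : ∀ a b, MemLp (fun ω => X ω a b) 2 μ := fun a b =>
    (memLp_two_iff_integrable_sq (hX.measurable a b).aestronglyMeasurable).2 (hX.integrable_sq a b)
  have hcorr : ∫ ω, X ω j k * X ω k j ∂μ = ρ := by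
    rcases lt_or_gt_of_ne hjk with h | h
    · exact hX.correlation j k h
    · rw [← hX.correlation k j h]
      congr with ω
      ring
  have tail : ∀ a b, ∫ ω in {ω | T < |X ω a b|}, X ω a b ^ 2 ∂μ ≤ (1 - |ρ|) / 128 := fun a b => by
    have := hφ T a b
    simp only [sq_abs] at this
    exact this.trans hφT
  refine isSpreadLaw_of_moments hρ hT ?_ ?_ ?_ ?_ ?_ ?_ ?_ ?_ ?_
  · rw [memLp_map_measure_iff (by fun_prop) hm.aemeasurable]; exact hmem j k
  · rw [memLp_map_measure_iff (by fun_prop) hm.aemeasurable]; exact hmem k j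
  · rw [integral_map hm.aemeasurable (by fun_prop)]; exact hX.mean_zero j k
  · rw [integral_map hm.aemeasurable (by fun_prop)]; exact hX.mean_zero k j
  · rw [integral_map hm.aemeasurable (by fun_prop)]; exact hX.variance_one j k
  · rw [integral_map hm.aemeasurable (by fun_prop)]; exact hX.variance_one k j
  · rw [integral_map hm.aemeasurable (by fun_prop)]; exact hcorr
  · rw [setIntegral_map (measurableSet_lt measurable_const (by fun_prop)) (by fun_prop)
      hm.aemeasurable]
    exact tail j k
  · rw [setIntegral_map (measurableSet_lt measurable_const (by fun_prop)) (by fun_prop)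
      hm.aemeasurable]
    exact tail k j

end

-- Nets of sparse vectors and the union bound.

section
variable {𝕜 : Type*} [RCLike 𝕜]

/-- Nearly null vectors on the rows `R` are not concentrated on few coordinates: they have at least
`m` coordinates which are larger than `τ`. -/
def SpreadsNullVectors {ι : Type*} [Fintype ι] (B : Matrix ι ι 𝕜) (R : Finset ι) (m : ℕ)
    (τ s : ℝ) : Prop :=
  ∀ y : ι → 𝕜, ‖y‖ = 1 → (∀ i ∈ R, ‖(B.mulVec y) i‖ ≤ s) →
    m ≤ (Finset.univ.filter fun j => τ < ‖y j‖).card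

/-- The grid of mesh `τ` in `𝕜` with `2 N + 1` points per real direction. -/
noncomputable def scalarGrid (𝕜 : Type*) [RCLike 𝕜] (τ : ℝ) (N : ℕ) : Finset 𝕜 := by
  classical
  exact (Finset.Icc (-(N : ℤ)) N ×ˢ Finset.Icc (-(N : ℤ)) N).image
    fun p : ℤ × ℤ => (((p.1 : ℝ) * τ : ℝ) : 𝕜) + (((p.2 : ℝ) * τ : ℝ) : 𝕜) * RCLike.I

theorem card_scalarGrid_le (τ : ℝ) (N : ℕ) : (scalarGrid 𝕜 τ N).card ≤ (2 * N + 1) ^ 2 := by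
  classical
  refine Finset.card_image_le.trans (le_of_eq ?_)
  rw [Finset.card_product, Int.card_Icc, sq]
  congr 1 <;> omega

theorem exists_mem_scalarGrid {τ : ℝ} {N : ℕ} (hτ : 0 < τ) (hN : 1 ≤ N * τ) (z : 𝕜) (hz : ‖z‖ ≤ 1) :
    ∃ g ∈ scalarGrid 𝕜 τ N, ‖z - g‖ ≤ 2 * τ := by
  classical
  have key : ∀ x : ℝ, |x| ≤ 1 → ∃ a ∈ Finset.Icc (-(N : ℤ)) N, |x - (a : ℝ) * τ| ≤ τ := by
    intro x hx
    obtain ⟨hx1, hx2⟩ := abs_le.1 hx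
    refine ⟨⌊x / τ⌋, Finset.mem_Icc.2 ⟨Int.le_floor.2 ?_, ?_⟩, ?_⟩
    · push_cast
      rw [le_div_iff₀ hτ]; nlinarith
    · have h1 : ((⌊x / τ⌋ : ℤ) : ℝ) ≤ N := by
        refine (Int.floor_le _).trans ?_
        rw [div_le_iff₀ hτ]; linarith
      exact_mod_cast h1
    · have h1 := Int.floor_le (x / τ)
      have h2 := (Int.lt_floor_add_one (x / τ)).le
      rw [le_div_iff₀ hτ] at h1
      rw [div_le_iff₀ hτ] at h2
      rw [abs_le]
      constructor <;> linarith
  obtain ⟨a, ha, ha'⟩ := key (RCLike.re z) ((RCLike.abs_re_le_norm z).trans hz)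
  obtain ⟨b, hb, hb'⟩ := key (RCLike.im z) ((RCLike.abs_im_le_norm z).trans hz)
  refine ⟨_, Finset.mem_image.2 ⟨(a, b), Finset.mem_product.2 ⟨ha, hb⟩, rfl⟩, ?_⟩
  have e : z - ((((a : ℝ) * τ : ℝ) : 𝕜) + (((b : ℝ) * τ : ℝ) : 𝕜) * RCLike.I) =
      ((RCLike.re z - (a : ℝ) * τ : ℝ) : 𝕜) + ((RCLike.im z - (b : ℝ) * τ : ℝ) : 𝕜) * RCLike.I := by
    conv_lhs => rw [← RCLike.re_add_im z]
    push_cast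
    ring
  dsimp only
  rw [e]
  -- Over `ℝ` the imaginary unit is 0, hence only an inequality.
  have hI : ‖(RCLike.I : 𝕜)‖ ≤ 1 := by
    rcases RCLike.I_mul_I (K := 𝕜) with h | h
    · simp [h]
    · have := congrArg norm h
      rw [norm_mul, norm_neg, norm_one] at this
      nlinarith [norm_nonneg (RCLike.I : 𝕜)]
  refine (norm_add_le _ _).trans ?_
  rw [norm_mul, RCLike.norm_ofReal, RCLike.norm_ofReal]
  nlinarith [abs_nonneg (RCLike.im z - (b : ℝ) * τ), norm_nonneg (RCLike.I : 𝕜)]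

/-- Vectors supported on `m` coordinates with values in `G`. -/
noncomputable def sparseNet {ι : Type*} [Fintype ι] (m : ℕ) (G : Finset 𝕜) : Finset (ι → 𝕜) := by
  classical
  exact (Finset.powersetCard m Finset.univ).biUnion fun T : Finset ι =>
    Fintype.piFinset fun j => if j ∈ T then G else {0}

theorem card_sparseNet_le {ι : Type*} [Fintype ι] (m : ℕ) (G : Finset 𝕜) :
    (sparseNet (ι := ι) m G).card ≤ (Fintype.card ι * G.card) ^ m := by
  classical
  refine (Finset.card_biUnion_le_card_mul _ _ (G.card ^ m) fun T hT => ?_).trans ?_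
  · rw [Fintype.card_piFinset, ← (Finset.mem_powersetCard.1 hT).2]
    refine le_of_eq ?_
    rw [← Finset.prod_const, ← Finset.prod_subset (Finset.subset_univ T)]
    · exact Finset.prod_congr rfl fun j hj => by simp [hj]
    · intro j _ hj
      simp [hj]
  · rw [Finset.card_powersetCard, mul_pow, Finset.card_univ]
    exact Nat.mul_le_mul_right _ (Nat.choose_le_pow _ _)

theorem exists_mem_sparseNet {ι : Type*} [Fintype ι] {τ : ℝ} {N m : ℕ} (hτ : 0 < τ)
    (hN : 1 ≤ N * τ) (hm : m ≤ Fintype.card ι) {y : ι → 𝕜} (hy : ‖y‖ = 1)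
    (hsp : (Finset.univ.filter fun j => τ < ‖y j‖).card < m) :
    ∃ z ∈ sparseNet (ι := ι) m (scalarGrid 𝕜 τ N), ∀ j, ‖y j - z j‖ ≤ 2 * τ := by
  classical
  -- The set of large coordinates is padded to exactly `m` elements. Values on `T` are rounded to
  -- the grid and the others, of norm at most `τ`, are replaced by 0.
  obtain ⟨T, hT1, -, hT2⟩ := Finset.exists_subsuperset_card_eq
    (Finset.subset_univ (Finset.univ.filter fun j => τ < ‖y j‖)) hsp.le
    (hm.trans_eq Finset.card_univ.symm)
  choose g hg hg' using fun j => exists_mem_scalarGrid hτ hN (y j) (hy ▸ norm_le_pi_norm y j)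
  refine ⟨fun j => if j ∈ T then g j else 0, ?_, fun j => ?_⟩
  · refine Finset.mem_biUnion.2 ⟨T, Finset.mem_powersetCard.2 ⟨Finset.subset_univ _, hT2⟩, ?_⟩
    refine Fintype.mem_piFinset.2 fun j => ?_
    by_cases hj : j ∈ T <;> simp [hj, hg]
  · by_cases hj : j ∈ T
    · simpa [hj] using hg' j
    · have : ¬ τ < ‖y j‖ := fun h => hj (hT1 (by simpa using h))
      simp only [hj, if_false, sub_zero]
      linarith

theorem exists_norm_apply_eq_norm {ι : Type*} [Fintype ι] (y : ι → 𝕜) (hy : y ≠ 0) :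
    ∃ k, ‖y k‖ = ‖y‖ := by
  have : Nonempty ι := by
    by_contra h
    rw [not_nonempty_iff] at h
    exact hy (Subsingleton.elim _ _)
  obtain ⟨k, hk⟩ := Finite.exists_max fun j => ‖y j‖
  exact ⟨k, le_antisymm (norm_le_pi_norm y k) ((pi_norm_le_iff_of_nonempty _).2 hk)⟩

theorem norm_mulVec_apply_le {ι κ : Type*} [Fintype ι] {B : Matrix κ ι 𝕜} {Λ b : ℝ}
    (hB : ∀ i j, ‖B i j‖ ≤ Λ) {y : ι → 𝕜} (hy : ∀ j, ‖y j‖ ≤ b) (i : κ) (hΛ : 0 ≤ Λ) :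
    ‖B.mulVec y i‖ ≤ Fintype.card ι * (Λ * b) := by
  rw [Matrix.mulVec, dotProduct]
  refine (norm_sum_le _ _).trans ?_
  rw [← nsmul_eq_mul, ← Finset.card_univ]
  refine Finset.sum_le_card_nsmul _ _ _ fun j _ => ?_
  rw [norm_mul]
  exact mul_le_mul (hB i j) (hy j) (norm_nonneg _) hΛ

/-- If `B` has a nearly null sparse vector then it has one in the net. -/
theorem exists_mem_sparseNet_of_not_spreads {ι : Type*} [Fintype ι] {B : Matrix ι ι 𝕜}
    {R : Finset ι} {τ s Λ : ℝ} {N m : ℕ} (hτ : 0 < τ) (hτ4 : τ ≤ 1 / 4) (hN : 1 ≤ N * τ)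
    (hΛ : 0 ≤ Λ) (hm : m ≤ Fintype.card ι) (hB : ∀ i j, ‖B i j‖ ≤ Λ)
    (h : ¬ SpreadsNullVectors B R m τ s) :
    ∃ z ∈ sparseNet (ι := ι) m (scalarGrid 𝕜 τ N), (∃ k, 1 / 2 ≤ ‖z k‖) ∧
      ∀ i ∈ R, ‖B.mulVec z i‖ ≤ s + Fintype.card ι * (Λ * (2 * τ)) := by
  rw [SpreadsNullVectors] at h
  push Not at h
  obtain ⟨y, hy, hyR, hsp⟩ := h
  obtain ⟨z, hz, hyz⟩ := exists_mem_sparseNet hτ hN hm hy hsp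
  refine ⟨z, hz, ?_, fun i hi => ?_⟩
  · obtain ⟨k, hk⟩ := exists_norm_apply_eq_norm y (norm_ne_zero_iff.1 (by rw [hy]; exact one_ne_zero))
    refine ⟨k, ?_⟩
    have h1 := hyz k
    have h2 := norm_sub_norm_le (y k) (z k)
    rw [hk, hy] at h2
    linarith
  · have e : B.mulVec z i = B.mulVec y i - B.mulVec (y - z) i := by
      rw [Matrix.mulVec_sub]; simp
    rw [e]
    refine (norm_sub_le _ _).trans ?_
    gcongr
    · exact hyR i hi
    · exact norm_mulVec_apply_le hB hyz i hΛ

/-- The matrix with entries `x i j + M i j`. -/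
def shiftMatrix {n : ℕ} (M : Matrix (Fin n) (Fin n) 𝕜) (x : Fin n → Fin n → ℝ) :
    Matrix (Fin n) (Fin n) 𝕜 :=
  Matrix.of fun i j => (x i j : 𝕜) + M i j

theorem continuous_shiftMatrix_mulVec {n : ℕ} (M : Matrix (Fin n) (Fin n) 𝕜) (y : Fin n → 𝕜)
    (i : Fin n) : Continuous fun x : Fin n → Fin n → ℝ => (shiftMatrix M x).mulVec y i := by
  simp only [Matrix.mulVec, dotProduct, shiftMatrix, Matrix.of_apply]
  fun_prop

theorem shiftMatrix_ofCross_mulVec {n : ℕ} (M : Matrix (Fin n) (Fin n) 𝕜) (k : Fin n)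
    (Z : Fin n → Fin n → ℝ) (ξ : {j // j ≠ k} → ℝ × ℝ) (y : Fin n → 𝕜) (i : {j // j ≠ k}) :
    (shiftMatrix M (ofCross k Z ξ)).mulVec y i = ((ξ i).1 : 𝕜) * y k +
      (M i k * y k + ∑ l : {l // l ≠ k}, ((Z i l : 𝕜) + M i l) * y l) := by
  rw [Matrix.mulVec, dotProduct, Fintype.sum_eq_add_sum_subtype_ne _ k]
  have h1 : shiftMatrix M (ofCross k Z ξ) i k = ((ξ i).1 : 𝕜) + M i k := by
    simp [shiftMatrix, ofCross, i.2]
  have h2 : ∀ l : {l // l ≠ k}, shiftMatrix M (ofCross k Z ξ) i l = (Z i l : 𝕜) + M i l :=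
    fun l => by simp [shiftMatrix, ofCross, i.2, l.2]
  simp only [h1, h2]
  ring

variable {Ω : Type*} [MeasurableSpace Ω] {μ : Measure Ω} [IsProbabilityMeasure μ] {ρ : ℝ} {n : ℕ}
  {X : Ω → Matrix (Fin n) (Fin n) ℝ}

theorem measurableSet_mulVec_small {ι : Type*} (M : Matrix (Fin n) (Fin n) 𝕜) (y : Fin n → 𝕜)
    (R : Finset ι) (f : ι → Fin n) (s : ℝ) :
    MeasurableSet {x : Fin n → Fin n → ℝ | ∀ i ∈ R, ‖(shiftMatrix M x).mulVec y (f i)‖ ≤ s} := by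
  have : {x : Fin n → Fin n → ℝ | ∀ i ∈ R, ‖(shiftMatrix M x).mulVec y (f i)‖ ≤ s} =
      ⋂ i ∈ R, {x | ‖(shiftMatrix M x).mulVec y (f i)‖ ≤ s} := by
    ext x; simp
  rw [this]
  refine Finset.measurableSet_biInter _ fun i _ => ?_
  exact (isClosed_le (continuous_shiftMatrix_mulVec M y (f i)).norm continuous_const).measurableSet

/-- A fixed vector with one large coordinate is very unlikely to be nearly null. -/
theorem measureReal_mulVec_small_le (hX : IsCorrelatedRandomMatrix μ ρ X) {κ δ : ℝ} (hδ : 0 < δ)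
    (hδ1 : δ ≤ 1)
    (hsp : ∀ j k, j ≠ k → IsSpreadLaw κ δ (μ.map fun ω => (X ω j k, X ω k j)))
    (M : Matrix (Fin n) (Fin n) 𝕜) {ι : Type*} (f : ι ↪ Fin n) (y : Fin n → 𝕜) (k : Fin n) {s : ℝ}
    (hs : 2 * s < κ * ‖y k‖) (R : Finset ι) :
    μ.real {ω | ∀ i ∈ R, ‖(shiftMatrix M (fun i j => X ω i j)).mulVec y (f i)‖ ≤ s}
      ≤ (1 - δ / 2) ^ (R.card - 1) := by
  classical
  have hb0 : 0 ≤ 1 - δ / 2 := by linarith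
  have hb1 : 1 - δ / 2 ≤ 1 := by linarith
  have hprob : ∀ j : {j // j ≠ k}, IsProbabilityMeasure (μ.map fun ω => (X ω j k, X ω k j)) :=
    fun j => Measure.isProbabilityMeasure_map
      ((hX.measurable _ _).prodMk (hX.measurable _ _)).aemeasurable
  have := hX.measureReal_le_of_sections k (measurableSet_mulVec_small M y R f s)
    MeasurableSet.empty (q := (1 - δ / 2) ^ (R.card - 1)) (by positivity) (fun Z _ => ?_)
  · simpa using this
  set R' : Finset {j // j ≠ k} := Finset.univ.filter fun j => j.1 ∈ R.map f with hR'
  -- Row `k` is lost because its entry in column `k` is diagonal and therefore frozen.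
  have hcard : R.card - 1 ≤ R'.card := by
    have h1 : (R.map f).erase k ⊆ R'.map (Function.Embedding.subtype _) := by
      intro j hj
      rw [Finset.mem_erase] at hj
      exact Finset.mem_map.2 ⟨⟨j, hj.1⟩, by simpa [hR'] using hj.2, rfl⟩
    have h2 := Finset.card_le_card h1
    rw [Finset.card_map] at h2
    have h3 := Finset.pred_card_le_card_erase (s := R.map f) (a := k)
    rw [Finset.card_map] at h3
    omega
  set c : {j // j ≠ k} → 𝕜 := fun i =>
    M i k * y k + ∑ l : {l // l ≠ k}, ((Z i l : 𝕜) + M i l) * y l with hc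
  set A : {j // j ≠ k} → Set (ℝ × ℝ) := fun j =>
    if j ∈ R' then {p | ‖(p.1 : 𝕜) * y k + c j‖ ≤ s} else Set.univ with hA
  have hsub : {ξ : {j // j ≠ k} → ℝ × ℝ | ofCross k Z ξ ∈
      {x : Fin n → Fin n → ℝ | ∀ i ∈ R, ‖(shiftMatrix M x).mulVec y (f i)‖ ≤ s}} ⊆
      Set.univ.pi A := by
    intro ξ hξ j _
    by_cases hj : j ∈ R'
    · obtain ⟨i, hi, hij⟩ := Finset.mem_map.1 (Finset.mem_filter.1 hj).2
      have := hξ i hi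
      rw [hij, shiftMatrix_ofCross_mulVec] at this
      simp only [hA, hj, if_true]
      exact this
    · simp [hA, hj]
  refine (measureReal_mono hsub).trans ?_
  rw [measureReal_def, Measure.pi_pi, ENNReal.toReal_prod]
  have hle : ∀ j ∈ Finset.univ, ((μ.map fun ω => (X ω j.1 k, X ω k j.1)) (A j)).toReal ≤
      if j ∈ R' then 1 - δ / 2 else 1 := by
    intro j _
    split_ifs with hj
    · simp only [hA, hj, if_true]
      exact (hsp j k j.2).measureReal_norm_le (y k) (c j) hs
    · simp [hA, hj]
  refine (Finset.prod_le_prod (fun _ _ => ENNReal.toReal_nonneg) hle).trans ?_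
  rw [Finset.prod_ite_mem, Finset.univ_inter, Finset.prod_const]
  exact pow_le_pow_of_le_one hb0 hb1 hcard

/-- The event that a submatrix has a nearly null vector in the sparse net. -/
def netEvent {ι : Type*} [Fintype ι] (M : Matrix (Fin n) (Fin n) 𝕜) (f : ι ↪ Fin n) (R : Finset ι)
    (m : ℕ) (G : Finset 𝕜) (s : ℝ) : Set (Fin n → Fin n → ℝ) :=
  {x | ∃ z ∈ sparseNet (ι := ι) m G, (∃ k, 1 / 2 ≤ ‖z k‖) ∧
    ∀ i ∈ R, ‖((shiftMatrix M x).submatrix f f).mulVec z i‖ ≤ s}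

theorem submatrix_mulVec_eq_extend {ι : Type*} [Fintype ι] (W : Matrix (Fin n) (Fin n) 𝕜)
    (f : ι ↪ Fin n) (z : ι → 𝕜) (i : ι) :
    (W.submatrix f f).mulVec z i = W.mulVec (Function.extend f z 0) (f i) := by
  classical
  simp only [Matrix.mulVec, dotProduct, Matrix.submatrix_apply]
  symm
  rw [← Finset.sum_subset (Finset.subset_univ (Finset.univ.map f)), Finset.sum_map]
  · simp [f.injective.extend_apply]
  · intro j _ hj
    rw [Function.extend_apply']
    · simp
    · rintro ⟨i, rfl⟩
      exact hj (by simp)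

theorem netEvent_eq {ι : Type*} [Fintype ι] (M : Matrix (Fin n) (Fin n) 𝕜) (f : ι ↪ Fin n)
    (R : Finset ι) (m : ℕ) (G : Finset 𝕜) (s : ℝ) :
    netEvent M f R m G s = ⋃ z ∈ (sparseNet (ι := ι) m G).filter (fun z => ∃ k, 1 / 2 ≤ ‖z k‖),
      {x | ∀ i ∈ R, ‖(shiftMatrix M x).mulVec (Function.extend f z 0) (f i)‖ ≤ s} := by
  classical
  ext x
  simp only [netEvent, submatrix_mulVec_eq_extend, Set.mem_ofPred_eq, Set.mem_iUnion,
    Finset.mem_filter, exists_prop, and_assoc]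

theorem measurableSet_netEvent {ι : Type*} [Fintype ι] (M : Matrix (Fin n) (Fin n) 𝕜)
    (f : ι ↪ Fin n) (R : Finset ι) (m : ℕ) (G : Finset 𝕜) (s : ℝ) :
    MeasurableSet (netEvent M f R m G s) := by
  rw [netEvent_eq]
  exact Finset.measurableSet_biUnion _ fun z _ => measurableSet_mulVec_small M _ R f s

/-- Union bound over the net. Extension by zero turns a vector of the submatrix into one of the full
matrix, and its coordinate of size at least `1 / 2` supplies the fresh entries. -/
theorem measureReal_netEvent_le (hX : IsCorrelatedRandomMatrix μ ρ X) {κ δ : ℝ} (hδ : 0 < δ)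
    (hδ1 : δ ≤ 1) (hκ : 0 < κ)
    (hsp : ∀ j k, j ≠ k → IsSpreadLaw κ δ (μ.map fun ω => (X ω j k, X ω k j)))
    (M : Matrix (Fin n) (Fin n) 𝕜) {ι : Type*} [Fintype ι] (f : ι ↪ Fin n) (R : Finset ι)
    (m : ℕ) (G : Finset 𝕜) {s : ℝ} (hs : 4 * s < κ) :
    μ.real {ω | (fun i j => X ω i j) ∈ netEvent M f R m G s} ≤
      (n * G.card : ℕ) ^ m * (1 - δ / 2) ^ (R.card - 1) := by
  have hb0 : 0 ≤ 1 - δ / 2 := by linarith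
  rw [netEvent_eq]
  simp only [Set.mem_iUnion, Set.ofPred_exists]
  refine (measureReal_biUnion_finset_le _ _).trans ?_
  refine (Finset.sum_le_card_nsmul _ _ ((1 - δ / 2) ^ (R.card - 1)) fun z hz => ?_).trans ?_
  · obtain ⟨k, hk⟩ := (Finset.mem_filter.1 hz).2
    refine measureReal_mulVec_small_le hX hδ hδ1 hsp M f _ (f k) ?_ R
    rw [f.injective.extend_apply]
    nlinarith
  · rw [nsmul_eq_mul]
    refine mul_le_mul_of_nonneg_right ?_ (by positivity)
    have h1 : Fintype.card ι ≤ n := by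
      simpa using Fintype.card_le_of_embedding f
    have h2 := (Finset.card_filter_le (sparseNet (ι := ι) m G) (fun z => ∃ k, 1 / 2 ≤ ‖z k‖)).trans
      ((card_sparseNet_le m G).trans (Nat.pow_le_pow_left (Nat.mul_le_mul_right G.card h1) m))
    exact_mod_cast h2

end

-- Decoupling.

theorem sq_lintegral_le_lintegral_sq {α : Type*} [MeasurableSpace α] {P : Measure α}
    [IsProbabilityMeasure P] {f : α → ENNReal} (hf : AEMeasurable f P) :
    (∫⁻ x, f x ∂P) ^ 2 ≤ ∫⁻ x, f x ^ 2 ∂P := by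
  have h := ENNReal.lintegral_mul_le_Lp_mul_Lq P Real.HolderConjugate.two_two hf
    (aemeasurable_const (b := (1 : ENNReal)))
  simp only [Pi.mul_apply, mul_one, ENNReal.one_rpow, lintegral_one, measure_univ] at h
  have h2 := pow_le_pow_left' h 2
  refine h2.trans (le_of_eq ?_)
  rw [← ENNReal.rpow_natCast, ← ENNReal.rpow_mul]
  simp

/-- The coordinates in `J` are taken from `ξ`, the others from `η`. -/
def mixCoord {ι E : Type*} [DecidableEq ι] (J : Finset ι) (ξ η : ι → E) : ι → E :=
  fun j => if j ∈ J then ξ j else η j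

theorem measurePreserving_mixCoord {ι E : Type*} [Fintype ι] [DecidableEq ι] [MeasurableSpace E]
    (ν : ι → Measure E) [∀ i, IsProbabilityMeasure (ν i)] (J : Finset ι) :
    MeasurePreserving (fun p : (ι → E) × (ι → E) => mixCoord J p.1 p.2)
      ((Measure.pi ν).prod (Measure.pi ν)) (Measure.pi ν) := by
  have h1 := (measurePreserving_arrowProdEquivProdArrow E E ι ν ν).symm
  exact (measurePreserving_mix ν J).comp h1

/-- Decoupling: the square of a probability is bounded by the probability that the event happens
for two configurations which share the coordinates outside `J`. -/
theorem sq_pi_real_le_of_decoupled {ι E : Type*} [Fintype ι] [DecidableEq ι] [MeasurableSpace E]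
    (ν : ι → Measure E) [∀ i, IsProbabilityMeasure (ν i)] (J : Finset ι) {F : Set (ι → E)}
    (hF : MeasurableSet F) {Bad : Set ((ι → E) × (ι → E))} (hBad : MeasurableSet Bad) {q : ℝ}
    (hq : 0 ≤ q)
    (h : ∀ ξ ξ', (ξ, ξ') ∉ Bad →
      (Measure.pi ν).real {η | mixCoord J ξ η ∈ F ∧ mixCoord J ξ' η ∈ F} ≤ q) :
    (Measure.pi ν).real F ^ 2 ≤ ((Measure.pi ν).prod (Measure.pi ν)).real Bad + q := by
  set P := Measure.pi ν with hP
  have hmix := measurePreserving_mixCoord ν J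
  set T : Set ((ι → E) × (ι → E)) := {p | mixCoord J p.1 p.2 ∈ F} with hT
  have hTm : MeasurableSet T := hmix.measurable hF
  have h1 : P F = ∫⁻ η, P {ξ | mixCoord J ξ η ∈ F} ∂P := by
    rw [← hmix.measure_preimage hF.nullMeasurableSet, Measure.prod_apply_symm (hmix.measurable hF)]
    rfl
  have hfm : Measurable fun η => P {ξ | mixCoord J ξ η ∈ F} := measurable_measure_prodMk_right hTm
  set D : Set (((ι → E) × (ι → E)) × (ι → E)) :=
    {p | mixCoord J p.1.1 p.2 ∈ F ∧ mixCoord J p.1.2 p.2 ∈ F} with hD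
  have hDm : MeasurableSet D := by
    refine MeasurableSet.inter ?_ ?_
    · exact hmix.measurable.comp
        ((measurable_fst.comp measurable_fst).prodMk measurable_snd) hF
    · exact hmix.measurable.comp
        ((measurable_snd.comp measurable_fst).prodMk measurable_snd) hF
  have h2 : P F ^ 2 ≤ (P.prod P) Bad + ENNReal.ofReal q := by
    -- Cauchy–Schwarz in the shared configuration `η`. The square of the inner probability is that
    -- of two independent copies `ξ`, `ξ'`, and Fubini then puts `η` innermost.
    calc P F ^ 2 ≤ ∫⁻ η, P {ξ | mixCoord J ξ η ∈ F} ^ 2 ∂P := by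
          rw [h1]; exact sq_lintegral_le_lintegral_sq hfm.aemeasurable
      _ = ∫⁻ η, (P.prod P) ((fun p => (p, η)) ⁻¹' D) ∂P := by
          refine lintegral_congr fun η => ?_
          rw [sq, ← Measure.prod_prod]
          rfl
      _ = ∫⁻ p, P (Prod.mk p ⁻¹' D) ∂(P.prod P) := by
          rw [← Measure.prod_apply_symm hDm, Measure.prod_apply hDm]
      _ ≤ ∫⁻ p, (Bad.indicator 1 p + ENNReal.ofReal q) ∂(P.prod P) := by
          refine lintegral_mono fun p => ?_
          by_cases hp : p ∈ Bad
          · simp only [hp, Set.indicator_of_mem, Pi.one_apply]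
            exact prob_le_one.trans le_self_add
          · have h3 : P (Prod.mk p ⁻¹' D) ≤ ENNReal.ofReal q :=
              (ENNReal.le_ofReal_iff_toReal_le (measure_ne_top _ _) hq).2 (h p.1 p.2 hp)
            exact h3.trans le_add_self
      _ = _ := by
          rw [lintegral_add_left (measurable_one.indicator hBad), lintegral_indicator_one hBad]
          simp
  have h3 := ENNReal.toReal_mono (by finiteness) h2
  rwa [ENNReal.toReal_add (by finiteness) (by finiteness), ENNReal.toReal_ofReal hq,
    ENNReal.toReal_pow] at h3

theorem IsSpreadLaw.prod_pi_real_le {ι : Type*} [Fintype ι] [DecidableEq ι] {κ δ : ℝ}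
    {ν : ι → Measure (ℝ × ℝ)} [∀ i, IsProbabilityMeasure (ν i)]
    (hν : ∀ i, IsSpreadLaw κ δ (ν i)) (J : Finset ι) :
    ((Measure.pi ν).prod (Measure.pi ν)).real {p | ∀ j ∈ J, |(p.1 j).1 - (p.2 j).1| < κ}
      ≤ (1 - δ) ^ J.card := by
  have h1 := measurePreserving_arrowProdEquivProdArrow (ℝ × ℝ) (ℝ × ℝ) ι ν ν
  have h2 := h1.measure_preimage_equiv {p | ∀ j ∈ J, |(p.1 j).1 - (p.2 j).1| < κ}
  rw [measureReal_def, ← h2]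
  set A : ι → Set ((ℝ × ℝ) × (ℝ × ℝ)) := fun j =>
    if j ∈ J then {p | |p.1.1 - p.2.1| < κ} else Set.univ with hA
  have hsub : (MeasurableEquiv.arrowProdEquivProdArrow (ℝ × ℝ) (ℝ × ℝ) ι) ⁻¹'
      {p | ∀ j ∈ J, |(p.1 j).1 - (p.2 j).1| < κ} ⊆ Set.univ.pi A := by
    intro ω hω j _
    by_cases hj : j ∈ J
    · simp only [hA, hj, if_true]
      exact hω j hj
    · simp [hA, hj]
  refine (ENNReal.toReal_mono (measure_ne_top _ _) (measure_mono hsub)).trans ?_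
  rw [Measure.pi_pi, ENNReal.toReal_prod]
  have hle : ∀ j ∈ Finset.univ, (((ν j).prod (ν j)) (A j)).toReal ≤ if j ∈ J then 1 - δ else 1 := by
    intro j _
    split_ifs with hj
    · simp only [hA, hj, if_true]
      have := hν j 1 0
      simpa [measureReal_def] using this
    · simp [hA, hj]
  refine (Finset.prod_le_prod (fun _ _ => ENNReal.toReal_nonneg) hle).trans ?_
  rw [Finset.prod_ite_mem, Finset.univ_inter, Finset.prod_const]

-- Bordered matrices with a fixed block.

section
variable {𝕜 : Type*} [RCLike 𝕜] {ι : Type*} [Fintype ι]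

/-- The configurations of a row and a column for which the matrix with corner `w`, first column
`ξ.1 + a₀`, first row `ξ.2 + b₀` and remaining block `B` has a nearly null vector with a large
first coordinate. -/
def borderedNullEvent (B : Matrix ι ι 𝕜) (w : 𝕜) (a₀ b₀ : ι → 𝕜) (Λ τ ε : ℝ) : Set (ι → ℝ × ℝ) :=
  {ξ | (∀ i, ‖((ξ i).2 : 𝕜) + b₀ i‖ ≤ Λ) ∧ ∃ (x₀ : 𝕜) (x : ι → 𝕜), τ ≤ ‖x₀‖ ∧ (∀ i, ‖x i‖ ≤ 1) ∧
    ‖w * x₀ + ∑ i, (((ξ i).2 : 𝕜) + b₀ i) * x i‖ ≤ ε ∧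
    ∀ i, ‖(((ξ i).1 : 𝕜) + a₀ i) * x₀ + B.mulVec x i‖ ≤ ε}

theorem norm_dotProduct_le {v w : ι → 𝕜} {a b : ℝ} (ha : 0 ≤ a) (hv : ∀ i, ‖v i‖ ≤ a)
    (hw : ∀ i, ‖w i‖ ≤ b) : ‖v ⬝ᵥ w‖ ≤ Fintype.card ι * (a * b) := by
  rw [dotProduct]
  refine (norm_sum_le _ _).trans ?_
  rw [← nsmul_eq_mul, ← Finset.card_univ]
  refine Finset.sum_le_card_nsmul _ _ _ fun j _ => ?_
  rw [norm_mul]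
  exact mul_le_mul (hv j) (hw j) (norm_nonneg _) ha

variable {κ δ : ℝ} {ν : ι → Measure (ℝ × ℝ)} [∀ i, IsProbabilityMeasure (ν i)]
  {B : Matrix ι ι 𝕜} {w : 𝕜} {a₀ b₀ : ι → 𝕜} {Λ τ ε η s : ℝ} {m : ℕ}

/-- Pairing the block rows with `z` almost eliminates `B`: `(z ⬝ᵥ U) * x₀` is within `O(ε + η)` of 0
up to the dimension. Since `‖x₀‖ ≥ τ`, this confines a linear form in the column whose coefficients
`z` are spread. -/
theorem pi_real_borderedNullEvent_le_of_left_null (hδ : 0 < δ) (hκ : 0 < κ)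
    (hν : ∀ i, IsSpreadLaw κ δ (ν i)) (hτ : 0 < τ) (hm : 0 < m) {z : ι → 𝕜} (hz : ‖z‖ = 1)
    (hzB : ∀ j, ‖Matrix.vecMul z B j‖ ≤ η) (hη : 0 ≤ η)
    (hsp : m ≤ (Finset.univ.filter fun j => τ < ‖z j‖).card)
    (hsmall : 4 * (Fintype.card ι * (ε + η) / τ) < κ * τ) :
    (Measure.pi ν).real (borderedNullEvent B w a₀ b₀ Λ τ ε) ≤ 8 / √(δ * m) := by
  set I := Finset.univ.filter fun j => τ < ‖z j‖ with hI
  have h1 := IsSpreadLaw.pi_real_norm_sum_le hδ hκ hν z (fun _ => 0) (z ⬝ᵥ a₀) I (by omega)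
    (τ := τ) (fun i hi => (Finset.mem_filter.1 hi).2.le.trans (le_max_left _ _)) hsmall
  refine (measureReal_mono ?_).trans (h1.trans ?_)
  · rintro ξ ⟨-, x₀, x, hx₀, hx, -, hU⟩
    set U : ι → 𝕜 := fun i => ((ξ i).1 : 𝕜) + a₀ i with hUdef
    have hzn : ∀ i, ‖z i‖ ≤ 1 := fun i => hz ▸ norm_le_pi_norm z i
    have e1 : (z ⬝ᵥ U) * x₀ = z ⬝ᵥ (fun i => U i * x₀ + B.mulVec x i) - Matrix.vecMul z B ⬝ᵥ x := by
      rw [← Matrix.dotProduct_mulVec]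
      simp only [dotProduct, ← Finset.sum_sub_distrib, Finset.sum_mul]
      exact Finset.sum_congr rfl fun i _ => by ring
    have e2 : ‖(z ⬝ᵥ U) * x₀‖ ≤ Fintype.card ι * (ε + η) := by
      rw [e1]
      refine (norm_sub_le _ _).trans ?_
      have t1 := norm_dotProduct_le zero_le_one hzn hU
      have t2 := norm_dotProduct_le hη hzB hx
      linarith
    rw [norm_mul] at e2
    have e3 : ‖z ⬝ᵥ U‖ ≤ Fintype.card ι * (ε + η) / τ := by
      rw [le_div_iff₀ hτ]
      exact (mul_le_mul_of_nonneg_left hx₀ (norm_nonneg _)).trans e2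
    refine le_trans (le_of_eq ?_) e3
    congr 1
    simp only [dotProduct, ← Finset.sum_add_distrib, hUdef]
    exact Finset.sum_congr rfl fun i _ => by ring
  · have : (m : ℝ) ≤ I.card := by exact_mod_cast hsp
    have h2 : 0 < √(δ * m) := by positivity
    gcongr

theorem pi_real_bilinear_le [DecidableEq ι] (hδ : 0 < δ) (hκ : 0 < κ)
    (hν : ∀ i, IsSpreadLaw κ δ (ν i)) (hτ : 0 < τ) (hΛ : 0 < Λ) (hs : 0 ≤ s) (hm : 0 < m)
    {J : Finset ι} (hJ : 2 * J.card ≤ m) (hB : ∀ i j, ‖B i j‖ ≤ Λ) (hdet : IsUnit B.det)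
    (hsp : SpreadsNullVectors B Jᶜ m τ s)
    (hsmall : 8 * ε < κ * (τ * (κ / (Fintype.card ι * Λ)))) :
    (Measure.pi ν).real {ξ | ‖w - (fun i => ((ξ i).2 : 𝕜) + b₀ i) ⬝ᵥ
        B⁻¹.mulVec (fun i => ((ξ i).1 : 𝕜) + a₀ i)‖ ≤ ε} ^ 2 ≤
      (1 - δ) ^ J.card + 8 / √(δ * (m / 2)) := by
  set G := B⁻¹ with hG
  set U : (ι → ℝ × ℝ) → ι → 𝕜 := fun ξ i => ((ξ i).1 : 𝕜) + a₀ i with hU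
  set V : (ι → ℝ × ℝ) → ι → 𝕜 := fun ξ i => ((ξ i).2 : 𝕜) + b₀ i with hV
  set F : Set (ι → ℝ × ℝ) := {ξ | ‖w - V ξ ⬝ᵥ G.mulVec (U ξ)‖ ≤ ε} with hF
  have hcont : Continuous fun ξ => V ξ ⬝ᵥ G.mulVec (U ξ) := by
    simp only [Matrix.mulVec, dotProduct, hU, hV]
    fun_prop
  have hFm : MeasurableSet F :=
    (isClosed_le (continuous_const.sub hcont).norm continuous_const).measurableSet
  have hBadm : MeasurableSet {p : (ι → ℝ × ℝ) × (ι → ℝ × ℝ) |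
      ∀ j ∈ J, |(p.1 j).1 - (p.2 j).1| < κ} := by
    have : {p : (ι → ℝ × ℝ) × (ι → ℝ × ℝ) | ∀ j ∈ J, |(p.1 j).1 - (p.2 j).1| < κ} =
        ⋂ j ∈ J, {p | |(p.1 j).1 - (p.2 j).1| < κ} := by ext; simp
    rw [this]
    exact Finset.measurableSet_biInter _ fun j _ => measurableSet_lt (by fun_prop) measurable_const
  refine (sq_pi_real_le_of_decoupled ν J hFm hBadm (q := 8 / √(δ * (m / 2))) (by positivity)
    fun ξ ξ' hξ => ?_).trans (by gcongr; exact IsSpreadLaw.prod_pi_real_le hν J)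
  simp only [Set.mem_ofPred_eq] at hξ
  push Not at hξ
  obtain ⟨j₀, hj₀, hκj⟩ := hξ
  -- The two configurations differ only on `J`, by `u` in the column and `v` in the row. Outside the
  -- bad event `u` has an entry of size at least `κ`, which keeps `b = B⁻¹ u` from being too small.
  set u : ι → 𝕜 := fun j => if j ∈ J then (((ξ j).1 - (ξ' j).1 : ℝ) : 𝕜) else 0 with hu
  set v : ι → 𝕜 := fun j => if j ∈ J then (((ξ j).2 - (ξ' j).2 : ℝ) : 𝕜) else 0 with hv
  set b := G.mulVec u with hb
  set a := Matrix.vecMul v G with ha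
  have hBb : B.mulVec b = u := by
    rw [hb, Matrix.mulVec_mulVec, hG, Matrix.mul_nonsing_inv _ hdet, Matrix.one_mulVec]
  have hN : (0 : ℝ) < Fintype.card ι := by exact_mod_cast Fintype.card_pos_iff.2 ⟨j₀⟩
  have hbn : κ / (Fintype.card ι * Λ) ≤ ‖b‖ := by
    rw [div_le_iff₀ (by positivity)]
    have h1 := norm_mulVec_apply_le hB (norm_le_pi_norm b) j₀ hΛ.le
    rw [hBb] at h1
    simp only [hu, hj₀, if_true, RCLike.norm_ofReal] at h1
    linarith
  have hb0 : 0 < ‖b‖ := lt_of_lt_of_le (by positivity) hbn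
  have hspb := hsp (((‖b‖⁻¹ : ℝ) : 𝕜) • b) (by
    rw [norm_smul, RCLike.norm_ofReal, abs_of_pos (by positivity)]
    field_simp) (by
    intro i hi
    rw [Matrix.mulVec_smul, hBb]
    have hi' : i ∉ J := Finset.mem_compl.1 hi
    simpa [hu, hi'] using hs)
  -- Coordinates in `J` are frozen in the linear form. Removing them leaves at least half of the `m`
  -- large ones, as `2 * J.card ≤ m`.
  set I := (Finset.univ.filter fun j => τ < ‖(((‖b‖⁻¹ : ℝ) : 𝕜) • b) j‖) \ J with hI
  have hIcard : m ≤ 2 * I.card := by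
    have : (Finset.univ.filter fun j => τ < ‖(((‖b‖⁻¹ : ℝ) : 𝕜) • b) j‖).card - J.card ≤ I.card :=
      Finset.le_card_sdiff _ _
    omega
  -- Nothing is known about `a`. The spread condition bounds below by `max |a| |b|`, so large
  -- entries of `b` alone suffice even though the pairs are correlated.
  set a' : ι → 𝕜 := fun i => if i ∈ J then 0 else a i with ha'
  set b' : ι → 𝕜 := fun i => if i ∈ J then 0 else b i with hb'
  set c : 𝕜 := ∑ i, (a i * (a₀ i + if i ∈ J then ((ξ' i).1 : 𝕜) else 0) +
    b i * (b₀ i + if i ∈ J then ((ξ i).2 : 𝕜) else 0)) with hc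
  have hLO := IsSpreadLaw.pi_real_norm_sum_le hδ hκ hν a' b' c (t := 2 * ε)
    (τ := τ * (κ / (Fintype.card ι * Λ))) I (by omega) (fun i hi => by
      rw [hI, Finset.mem_sdiff, Finset.mem_filter] at hi
      obtain ⟨⟨-, hi1⟩, hi2⟩ := hi
      refine le_trans ?_ (le_max_right _ _)
      simp only [hb', hi2, if_false]
      rw [Pi.smul_apply, norm_smul, RCLike.norm_ofReal, abs_of_pos (by positivity),
        inv_mul_eq_div, lt_div_iff₀ hb0] at hi1
      refine le_trans ?_ hi1.le
      gcongr) (by linarith)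
  refine (measureReal_mono ?_).trans (hLO.trans ?_)
  · rintro η ⟨h1, h2⟩
    have h1' : ‖w - V (mixCoord J ξ η) ⬝ᵥ G.mulVec (U (mixCoord J ξ η))‖ ≤ ε := h1
    have h2' : ‖w - V (mixCoord J ξ' η) ⬝ᵥ G.mulVec (U (mixCoord J ξ' η))‖ ≤ ε := h2
    have eU : U (mixCoord J ξ η) = U (mixCoord J ξ' η) + u := by
      funext j
      by_cases hj : j ∈ J
      · simp only [hU, hu, mixCoord, hj, if_true, Pi.add_apply, RCLike.ofReal_sub]; ring
      · simp [hU, hu, mixCoord, hj]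
    have eV : V (mixCoord J ξ η) = V (mixCoord J ξ' η) + v := by
      funext j
      by_cases hj : j ∈ J
      · simp only [hV, hv, mixCoord, hj, if_true, Pi.add_apply, RCLike.ofReal_sub]; ring
      · simp [hV, hv, mixCoord, hj]
    -- The difference of the bilinear forms at `(U' + u, V' + v)` and `(U', V')` is `v G U' + V G
    -- u`, linear in the coordinates of `η` once `ξ`, `ξ'` are fixed.
    have e : (w - V (mixCoord J ξ' η) ⬝ᵥ G.mulVec (U (mixCoord J ξ' η))) -
        (w - V (mixCoord J ξ η) ⬝ᵥ G.mulVec (U (mixCoord J ξ η))) =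
        a ⬝ᵥ U (mixCoord J ξ' η) + V (mixCoord J ξ η) ⬝ᵥ b := by
      rw [ha, ← Matrix.dotProduct_mulVec, hb]
      rw [eU, Matrix.mulVec_add, dotProduct_add]
      rw [show V (mixCoord J ξ η) ⬝ᵥ G.mulVec (U (mixCoord J ξ' η)) =
        V (mixCoord J ξ' η) ⬝ᵥ G.mulVec (U (mixCoord J ξ' η)) +
          v ⬝ᵥ G.mulVec (U (mixCoord J ξ' η)) by rw [eV, add_dotProduct]]
      ring
    have e' : a ⬝ᵥ U (mixCoord J ξ' η) + V (mixCoord J ξ η) ⬝ᵥ b =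
        ∑ i, (((η i).1 : 𝕜) * a' i + ((η i).2 : 𝕜) * b' i) + c := by
      simp only [dotProduct, hc, ← Finset.sum_add_distrib]
      refine Finset.sum_congr rfl fun i _ => ?_
      by_cases hi : i ∈ J <;> simp [hU, hV, ha', hb', mixCoord, hi] <;> ring
    show ‖∑ i, (((η i).1 : 𝕜) * a' i + ((η i).2 : 𝕜) * b' i) + c‖ ≤ 2 * ε
    rw [← e', ← e]
    exact (norm_sub_le _ _).trans (by linarith)
  · have h3 : (m : ℝ) / 2 ≤ I.card := by
      rw [div_le_iff₀ two_pos]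
      have : (m : ℝ) ≤ 2 * I.card := by exact_mod_cast hIcard
      linarith
    have h4 : 0 < √(δ * ((m : ℝ) / 2)) := by positivity
    gcongr

/-- The small ball estimate for a bordered matrix with fixed block `B`. -/
theorem pi_real_borderedNullEvent_le [DecidableEq ι] (hδ : 0 < δ) (hδ1 : δ ≤ 1) (hκ : 0 < κ)
    (hν : ∀ i, IsSpreadLaw κ δ (ν i)) (hτ : 0 < τ) (hΛ : 0 < Λ) (hη : 0 < η)
    (hηs : η ≤ s) (hm : 0 < m) {J : Finset ι} (hJ : 2 * J.card ≤ m) (hB : ∀ i j, ‖B i j‖ ≤ Λ)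
    (hsp : SpreadsNullVectors B Jᶜ m τ s) (hspT : SpreadsNullVectors B.transpose Jᶜ m τ s)
    (hsmall : 4 * (Fintype.card ι * (ε + η) / τ) < κ * τ)
    (hsmall' : 8 * ((ε + Fintype.card ι * (Λ / η * ε)) / τ) <
      κ * (τ * (κ / (Fintype.card ι * Λ)))) :
    (Measure.pi ν).real (borderedNullEvent B w a₀ b₀ Λ τ ε) ≤
      √((1 - δ) ^ J.card + 8 / √(δ * (m / 2))) := by
  refine Real.le_sqrt_of_sq_le ?_
  have h1δ : 0 ≤ 1 - δ := by linarith
  -- The dichotomy is for left vectors at scale `η`. In the first case the linear bound is weakened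
  -- to a bound on the square, a probability being at least its square. In the second case `B` is
  -- invertible with `z ↦ z B` bounded below by `η`.
  by_cases hcase : ∃ z : ι → 𝕜, ‖z‖ = 1 ∧ ∀ j, ‖Matrix.vecMul z B j‖ ≤ η
  · obtain ⟨z, hz, hzB⟩ := hcase
    have hs1 := hspT z hz (fun i _ => by
      rw [Matrix.mulVec_transpose]; exact (hzB i).trans hηs)
    have h1 := pi_real_borderedNullEvent_le_of_left_null (w := w) (a₀ := a₀) (b₀ := b₀) (Λ := Λ)
      hδ hκ hν hτ hm hz hzB hη.le hs1 hsmall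
    have h2 : (Measure.pi ν).real (borderedNullEvent B w a₀ b₀ Λ τ ε) ≤ 1 := measureReal_le_one
    have h3 : 0 ≤ (Measure.pi ν).real (borderedNullEvent B w a₀ b₀ Λ τ ε) := measureReal_nonneg
    have h4 : 8 / √(δ * m) ≤ 8 / √(δ * (m / 2)) := by
      have : 0 < √(δ * ((m : ℝ) / 2)) := by positivity
      have hm' : (m : ℝ) / 2 ≤ m := by linarith [(Nat.cast_nonneg m : (0 : ℝ) ≤ m)]
      gcongr
    have h5 : 0 ≤ (1 - δ) ^ J.card := by positivity
    nlinarith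
  · push Not at hcase
    have hlow : ∀ z : ι → 𝕜, η * ‖z‖ ≤ ‖Matrix.vecMul z B‖ := by
      intro z
      rcases eq_or_ne z 0 with rfl | hz
      · simp
      have hzn : 0 < ‖z‖ := norm_pos_iff.2 hz
      obtain ⟨j, hj⟩ := hcase (((‖z‖⁻¹ : ℝ) : 𝕜) • z) (by
        rw [norm_smul, RCLike.norm_ofReal, abs_of_pos (by positivity)]
        field_simp)
      rw [Matrix.smul_vecMul, Pi.smul_apply, norm_smul, RCLike.norm_ofReal,
        abs_of_pos (by positivity), inv_mul_eq_div, lt_div_iff₀ hzn] at hj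
      exact hj.le.trans (norm_le_pi_norm _ j)
    have hdet : IsUnit B.det := by
      rw [isUnit_iff_ne_zero]
      intro h0
      obtain ⟨v, hv, hvB⟩ := Matrix.exists_vecMul_eq_zero_iff.2 h0
      have := hlow v
      rw [hvB, norm_zero] at this
      have hvn : 0 < ‖v‖ := norm_pos_iff.2 hv
      nlinarith
    refine le_trans ?_ (pi_real_bilinear_le (w := w) (a₀ := a₀) (b₀ := b₀) hδ hκ hν hτ hΛ
      (hη.le.trans hηs) hm hJ hB hdet hsp hsmall')
    refine pow_le_pow_left₀ measureReal_nonneg (measureReal_mono ?_) 2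
    rintro ξ ⟨hVΛ, x₀, x, hx₀, -, hwx, hU⟩
    set U : ι → 𝕜 := fun i => ((ξ i).1 : 𝕜) + a₀ i with hUdef
    set V : ι → 𝕜 := fun i => ((ξ i).2 : 𝕜) + b₀ i with hVdef
    set e : ι → 𝕜 := fun i => U i * x₀ + B.mulVec x i with he
    set g := Matrix.vecMul V B⁻¹ with hg
    have hgB : Matrix.vecMul g B = V := by
      rw [hg, Matrix.vecMul_vecMul, Matrix.nonsing_inv_mul _ hdet, Matrix.vecMul_one]
    have hgn : ∀ i, ‖g i‖ ≤ Λ / η := by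
      intro i
      rw [le_div_iff₀ hη, mul_comm]
      refine (mul_le_mul_of_nonneg_left (norm_le_pi_norm g i) hη.le).trans ((hlow g).trans ?_)
      rw [hgB]
      exact (pi_norm_le_iff_of_nonneg hΛ.le).2 hVΛ
    have hge : g ⬝ᵥ e = (V ⬝ᵥ B⁻¹.mulVec U) * x₀ + V ⬝ᵥ x := by
      have h1 : e = x₀ • U + B.mulVec x := by
        funext i; simp [he, mul_comm]
      rw [h1, dotProduct_add, dotProduct_smul, hg, Matrix.dotProduct_mulVec, Matrix.dotProduct_mulVec,
        ← hg, hgB, smul_eq_mul, mul_comm]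
    -- Schur complement: subtracting `g = V B⁻¹` times the block rows from the first row eliminates
    -- `x`. The entries of `g` are at most `Λ / η`.
    have hkey : (w - V ⬝ᵥ B⁻¹.mulVec U) * x₀ = (w * x₀ + V ⬝ᵥ x) - g ⬝ᵥ e := by
      rw [hge]; ring
    have hn : ‖(w - V ⬝ᵥ B⁻¹.mulVec U) * x₀‖ ≤ ε + Fintype.card ι * (Λ / η * ε) := by
      rw [hkey]
      refine (norm_sub_le _ _).trans (add_le_add hwx ?_)
      exact norm_dotProduct_le (by positivity) hgn hU
    rw [norm_mul] at hn
    show ‖w - V ⬝ᵥ B⁻¹.mulVec U‖ ≤ _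
    rw [le_div_iff₀ hτ]
    exact (mul_le_mul_of_nonneg_left hx₀ (norm_nonneg _)).trans hn

end

-- From the least singular value to single coordinates.

section
variable {𝕜 : Type*} [RCLike 𝕜] {n : ℕ}

/-- An eigenvector of `W* W` is rescaled to sup norm 1. The factor `n` is a crude bound for the `√n`
between the Euclidean and sup norms. -/
theorem exists_norm_mulVec_le_of_leastSingularValue_le (hn : 1 ≤ n) {W : Matrix (Fin n) (Fin n) 𝕜}
    {t : ℝ} (h : leastSingularValue W ≤ t) :
    ∃ y : Fin n → 𝕜, ‖y‖ = 1 ∧ ∀ i, ‖W.mulVec y i‖ ≤ n * t := by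
  set T := Matrix.toEuclideanLin W with hT
  have hdim : n - 1 < Module.finrank 𝕜 (EuclideanSpace 𝕜 (Fin n)) := by
    rw [finrank_euclideanSpace_fin]; omega
  obtain ⟨v, hv⟩ := (T.hasEigenvalue_adjoint_comp_self_sq_singularValues hdim).exists_hasEigenvector
  set σ := T.singularValues (n - 1) with hσ
  have hσ0 : 0 ≤ σ := T.singularValues_nonneg _
  have hσt : σ ≤ t := h
  have hTv : ‖T v‖ = σ * ‖v‖ := by
    have h1 := hv.apply_eq_smul
    have h2 : inner 𝕜 (T v) (T v) = ((σ ^ 2 : ℝ) : 𝕜) * inner 𝕜 v v := by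
      rw [← LinearMap.adjoint_inner_right, ← LinearMap.comp_apply, h1, inner_smul_right]
      push_cast
      rfl
    rw [inner_self_eq_norm_sq_to_K, inner_self_eq_norm_sq_to_K] at h2
    have h3 : ‖T v‖ ^ 2 = σ ^ 2 * ‖v‖ ^ 2 := by exact_mod_cast h2
    rw [← mul_pow] at h3
    exact (pow_left_inj₀ (norm_nonneg _) (by positivity) two_ne_zero).1 h3
  set y : Fin n → 𝕜 := fun i => v i with hy
  have hy0 : y ≠ 0 := by
    intro h0
    apply hv.2
    ext i
    exact congrFun h0 i
  have hyn : 0 < ‖y‖ := norm_pos_iff.2 hy0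
  have hn1 : (1 : ℝ) ≤ n := by exact_mod_cast hn
  have hvy : ‖v‖ ≤ n * ‖y‖ := by
    refine le_of_sq_le_sq ?_ (by positivity)
    rw [EuclideanSpace.norm_sq_eq]
    calc ∑ i, ‖v i‖ ^ 2 ≤ ∑ _i : Fin n, ‖y‖ ^ 2 :=
          Finset.sum_le_sum fun i _ => pow_le_pow_left₀ (norm_nonneg _) (norm_le_pi_norm y i) 2
      _ = n * ‖y‖ ^ 2 := by simp
      _ ≤ (n * ‖y‖) ^ 2 := by
          rw [mul_pow]
          refine mul_le_mul_of_nonneg_right ?_ (by positivity)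
          nlinarith
  refine ⟨((‖y‖⁻¹ : ℝ) : 𝕜) • y, ?_, fun i => ?_⟩
  · rw [norm_smul, RCLike.norm_ofReal, abs_of_pos (by positivity)]
    field_simp
  · have h1 : ‖W.mulVec y i‖ ≤ ‖T v‖ := PiLp.norm_apply_le (T v) i
    rw [Matrix.mulVec_smul, Pi.smul_apply, norm_smul, RCLike.norm_ofReal,
      abs_of_pos (by positivity), inv_mul_le_iff₀ hyn]
    calc ‖W.mulVec y i‖ ≤ σ * ‖v‖ := h1.trans hTv.le
      _ ≤ t * (n * ‖y‖) := mul_le_mul hσt hvy (norm_nonneg _) (hσ0.trans hσt)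
      _ = _ := by ring

theorem norm_entry_le_norm_toEuclideanCLM (M : Matrix (Fin n) (Fin n) 𝕜) (i j : Fin n) :
    ‖M i j‖ ≤ ‖Matrix.toEuclideanCLM (n := Fin n) (𝕜 := 𝕜) M‖ := by
  have h1 := (Matrix.toEuclideanCLM (n := Fin n) (𝕜 := 𝕜) M).le_opNorm
    (EuclideanSpace.single j 1)
  rw [PiLp.norm_single, norm_one, mul_one] at h1
  refine le_trans ?_ ((PiLp.norm_apply_le _ i).trans h1)
  refine le_of_eq ?_
  congr 1
  simp [Matrix.ofLp_toEuclideanCLM]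

/-- The arrays for which the shifted matrix has bounded entries and a nearly null vector with large
`k`-th coordinate. -/
def largeCoordEvent (M : Matrix (Fin n) (Fin n) 𝕜) (Λ τ ε : ℝ) (k : Fin n) :
    Set (Fin n → Fin n → ℝ) :=
  {x | (∀ i j, ‖shiftMatrix M x i j‖ ≤ Λ) ∧ ∃ y : Fin n → 𝕜, ‖y‖ ≤ 1 ∧ τ ≤ ‖y k‖ ∧
    ∀ i, ‖(shiftMatrix M x).mulVec y i‖ ≤ ε}

/-- The existential over `y` is a projection along the compact unit ball, so it preserves
closedness. -/
theorem measurableSet_largeCoordEvent (M : Matrix (Fin n) (Fin n) 𝕜) (Λ τ ε : ℝ) (k : Fin n) :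
    MeasurableSet (largeCoordEvent M Λ τ ε k) := by
  refine IsClosed.measurableSet ?_
  have hK : CompactSpace (Metric.closedBall (0 : Fin n → 𝕜) 1) :=
    isCompact_iff_compactSpace.1 (isCompact_closedBall _ _)
  set C : Set ((Fin n → Fin n → ℝ) × Metric.closedBall (0 : Fin n → 𝕜) 1) :=
    {p | (∀ i j, ‖shiftMatrix M p.1 i j‖ ≤ Λ) ∧ τ ≤ ‖p.2.1 k‖ ∧
      ∀ i, ‖(shiftMatrix M p.1).mulVec p.2.1 i‖ ≤ ε} with hC
  have hcoord : ∀ j, Continuous fun p : (Fin n → Fin n → ℝ) ×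
      Metric.closedBall (0 : Fin n → 𝕜) 1 => p.2.1 j := fun j =>
    (continuous_apply j).comp (continuous_subtype_val.comp continuous_snd)
  have hCc : IsClosed C := by
    simp only [hC, Matrix.mulVec, dotProduct, shiftMatrix, Matrix.of_apply, Set.ofPred_and,
      Set.ofPred_forall]
    refine IsClosed.inter (isClosed_iInter fun i => isClosed_iInter fun j => ?_)
      (IsClosed.inter ?_ (isClosed_iInter fun i => ?_))
    · exact isClosed_le (by fun_prop) (by fun_prop)
    · exact isClosed_le continuous_const (hcoord k).norm
    · refine isClosed_le (continuous_finsetSum _ fun j _ => Continuous.mul ?_ (hcoord j)).norm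
        continuous_const
      fun_prop
  have : largeCoordEvent M Λ τ ε k = Prod.fst '' C := by
    ext x
    constructor
    · rintro ⟨h1, y, hy, h2, h3⟩
      exact ⟨(x, ⟨y, mem_closedBall_zero_iff.2 hy⟩), ⟨h1, h2, h3⟩, rfl⟩
    · rintro ⟨⟨x, y⟩, ⟨h1, h2, h3⟩, rfl⟩
      exact ⟨h1, y.1, mem_closedBall_zero_iff.1 y.2, h2, h3⟩
  rw [this]
  exact isClosedMap_fst_of_compactSpace _ hCc

theorem shiftMatrix_ofCross_mem (M : Matrix (Fin n) (Fin n) 𝕜) {Λ τ ε : ℝ} {k : Fin n}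
    {Z : Fin n → Fin n → ℝ} {ξ : {j // j ≠ k} → ℝ × ℝ}
    (h : ofCross k Z ξ ∈ largeCoordEvent M Λ τ ε k) :
    (∀ i j, ‖(shiftMatrix M Z).submatrix (Subtype.val : {j // j ≠ k} → Fin n)
      (Subtype.val : {j // j ≠ k} → Fin n) i j‖ ≤ Λ) ∧
    ξ ∈ borderedNullEvent ((shiftMatrix M Z).submatrix (Subtype.val : {j // j ≠ k} → Fin n)
      (Subtype.val : {j // j ≠ k} → Fin n))
      ((Z k k : 𝕜) + M k k) (fun i => M i k) (fun i => M k i) Λ τ ε := by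
  obtain ⟨hΛ, y, hy, hyk, hW⟩ := h
  refine ⟨fun i j => ?_, fun i => ?_, y k, fun i => y i, hyk,
    fun i => (norm_le_pi_norm y i).trans hy, ?_, fun i => ?_⟩
  · have := hΛ i j
    simpa [shiftMatrix, ofCross, i.2, j.2] using this
  · have := hΛ k i
    simpa [shiftMatrix, ofCross, i.2] using this
  · have := hW k
    rw [Matrix.mulVec, dotProduct, Fintype.sum_eq_add_sum_subtype_ne _ k] at this
    simpa [shiftMatrix, ofCross, fun l : {l // l ≠ k} => l.2] using this
  · have := hW i
    rw [shiftMatrix_ofCross_mulVec, ← add_assoc, ← add_mul] at this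
    exact this

theorem shiftMatrix_offCross_submatrix (M : Matrix (Fin n) (Fin n) 𝕜) (k : Fin n)
    (x : Fin n → Fin n → ℝ) :
    (shiftMatrix M (offCross k x)).submatrix (Subtype.val : {j // j ≠ k} → Fin n)
      (Subtype.val : {j // j ≠ k} → Fin n) =
      (shiftMatrix M x).submatrix (Subtype.val : {j // j ≠ k} → Fin n)
      (Subtype.val : {j // j ≠ k} → Fin n) := by
  ext i j
  simp [shiftMatrix, offCross, i.2, j.2]

variable {Ω : Type*} [MeasurableSpace Ω] {μ : Measure Ω} [IsProbabilityMeasure μ] {ρ : ℝ}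
  {X : Ω → Matrix (Fin n) (Fin n) ℝ}

/-- Conditioning on everything outside row and column `k`: off the exceptional set where the block
or its transpose has a nearly null net vector on the rows `Jᶜ`, the bordered estimate applies. The
set `J` is deterministic. -/
theorem measureReal_largeCoordEvent_le (hX : IsCorrelatedRandomMatrix μ ρ X) {κ δ : ℝ} (hδ : 0 < δ)
    (hδ1 : δ ≤ 1) (hκ : 0 < κ)
    (hsp : ∀ j k, j ≠ k → IsSpreadLaw κ δ (μ.map fun ω => (X ω j k, X ω k j)))
    (M : Matrix (Fin n) (Fin n) 𝕜) (k : Fin n) {Λ τ s s' ε η : ℝ} {m N : ℕ} (hτ : 0 < τ)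
    (hτ4 : τ ≤ 1 / 4) (hN : 1 ≤ N * τ) (hΛ : 0 < Λ) (hη : 0 < η) (hηs : η ≤ s) (hm : 0 < m)
    (hmn : m < n) (hs : s + n * (Λ * (2 * τ)) ≤ s') (hs' : 4 * s' < κ)
    (hsmall : 4 * (((n - 1 : ℕ) : ℝ) * (ε + η) / τ) < κ * τ)
    (hsmall' : 8 * ((ε + ((n - 1 : ℕ) : ℝ) * (Λ / η * ε)) / τ) <
      κ * (τ * (κ / (((n - 1 : ℕ) : ℝ) * Λ)))) :
    μ.real {ω | (fun i j => X ω i j) ∈ largeCoordEvent M Λ τ ε k} ≤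
      2 * ((n * (scalarGrid 𝕜 τ N).card : ℕ) ^ m * (1 - δ / 2) ^ (n - 2 - m / 2)) +
        √((1 - δ) ^ (m / 2) + 8 / √(δ * (m / 2))) := by
  classical
  set f : {j // j ≠ k} ↪ Fin n := Function.Embedding.subtype _ with hf
  have hcard : Fintype.card {j // j ≠ k} = n - 1 := by simp
  obtain ⟨J, -, hJ⟩ := Finset.exists_subset_card_eq
    (s := (Finset.univ : Finset {j // j ≠ k})) (n := m / 2) (by rw [Finset.card_univ, hcard]; omega)
  -- The block has `n - 1` rows, `J` removes `m / 2`, and one more is lost to the frozen diagonal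
  -- entry.
  have hJc : Jᶜ.card - 1 = n - 2 - m / 2 := by
    rw [Finset.card_compl, hcard, hJ]; omega
  set G := scalarGrid 𝕜 τ N with hG
  set swapArr : (Fin n → Fin n → ℝ) → Fin n → Fin n → ℝ := fun x i j => x j i with hswap
  have hswapm : Measurable swapArr := by
    refine measurable_pi_lambda _ fun i => measurable_pi_lambda _ fun j => ?_
    simp only [hswap]
    fun_prop
  set Bad : Set (Fin n → Fin n → ℝ) := netEvent M f Jᶜ m G s' ∪
    swapArr ⁻¹' (netEvent M.transpose f Jᶜ m G s') with hBad
  have hBadm : MeasurableSet Bad :=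
    (measurableSet_netEvent M f Jᶜ m G s').union
      (hswapm (measurableSet_netEvent M.transpose f Jᶜ m G s'))
  have hprob : ∀ j : {j // j ≠ k}, IsProbabilityMeasure (μ.map fun ω => (X ω j k, X ω k j)) :=
    fun j => Measure.isProbabilityMeasure_map
      ((hX.measurable _ _).prodMk (hX.measurable _ _)).aemeasurable
  have hcond := hX.measureReal_le_of_sections k (measurableSet_largeCoordEvent M Λ τ ε k) hBadm
    (q := √((1 - δ) ^ (m / 2) + 8 / √(δ * (m / 2)))) (Real.sqrt_nonneg _) (fun Z hZ => ?_)
  · refine hcond.trans (add_le_add ?_ le_rfl)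
    have e1 : {ω | offCross k (X ω) ∈ Bad} ⊆
        {ω | (fun i j => X ω i j) ∈ netEvent M f Jᶜ m G s'} ∪
        {ω | (fun i j => (X ω).transpose i j) ∈ netEvent M.transpose f Jᶜ m G s'} := by
      rintro ω (hω | hω)
      · left
        simp only [netEvent, Set.mem_ofPred_eq] at hω ⊢
        have := shiftMatrix_offCross_submatrix M k (X ω)
        rw [show (f : {j // j ≠ k} → Fin n) = Subtype.val from rfl] at hω ⊢
        rw [this] at hω
        exact hω
      · right
        have e2 : swapArr (offCross k (X ω)) = offCross k (X ω).transpose := by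
          funext i j
          simp only [hswap, offCross, Matrix.transpose_apply]
          congr 1
          simp only [ne_comm, or_comm, ne_eq]
        rw [Set.mem_preimage, e2] at hω
        simp only [netEvent, Set.mem_ofPred_eq] at hω ⊢
        have := shiftMatrix_offCross_submatrix M.transpose k (X ω).transpose
        rw [show (f : {j // j ≠ k} → Fin n) = Subtype.val from rfl] at hω ⊢
        rw [this] at hω
        exact hω
    refine (measureReal_mono e1).trans ((measureReal_union_le _ _).trans ?_)
    rw [two_mul, ← hJc]
    refine add_le_add (measureReal_netEvent_le hX hδ hδ1 hκ hsp M f Jᶜ m G hs') ?_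
    exact measureReal_netEvent_le hX.transpose hδ hδ1 hκ (fun j k hjk => hsp k j hjk.symm)
      M.transpose f Jᶜ m G hs'
  · set B := (shiftMatrix M Z).submatrix (Subtype.val : {j // j ≠ k} → Fin n)
      (Subtype.val : {j // j ≠ k} → Fin n) with hB
    by_cases hBΛ : ∀ i j, ‖B i j‖ ≤ Λ
    · have hcn : (Fintype.card {j // j ≠ k} : ℝ) ≤ n := by
        rw [hcard]; exact_mod_cast Nat.sub_le n 1
      have hs2 : s + Fintype.card {j // j ≠ k} * (Λ * (2 * τ)) ≤ s' := by
        refine le_trans ?_ hs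
        gcongr
      have hsp1 : SpreadsNullVectors B Jᶜ m τ s := by
        by_contra hcon
        obtain ⟨z, hz, hzk, hzR⟩ := exists_mem_sparseNet_of_not_spreads hτ hτ4 hN hΛ.le
          (by rw [hcard]; omega) hBΛ hcon
        exact hZ (Or.inl ⟨z, hz, hzk, fun i hi => (hzR i hi).trans hs2⟩)
      have hsp2 : SpreadsNullVectors B.transpose Jᶜ m τ s := by
        by_contra hcon
        obtain ⟨z, hz, hzk, hzR⟩ := exists_mem_sparseNet_of_not_spreads hτ hτ4 hN hΛ.le
          (by rw [hcard]; omega) (fun i j => hBΛ j i) hcon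
        exact hZ (Or.inr ⟨z, hz, hzk, fun i hi => (hzR i hi).trans hs2⟩)
      have hmain := pi_real_borderedNullEvent_le (w := (Z k k : 𝕜) + M k k)
        (a₀ := fun i : {j // j ≠ k} => M i k) (b₀ := fun i : {j // j ≠ k} => M k i)
        hδ hδ1 hκ (fun j => hsp j k j.2) hτ hΛ hη hηs hm (J := J) (by omega) hBΛ hsp1 hsp2
        (by rw [hcard]; exact hsmall) (by rw [hcard]; exact hsmall')
      rw [hJ] at hmain
      refine (measureReal_mono fun ξ hξ => ?_).trans hmain
      exact (shiftMatrix_ofCross_mem M hξ).2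
    · have : {ξ : {j // j ≠ k} → ℝ × ℝ | ofCross k Z ξ ∈ largeCoordEvent M Λ τ ε k} = ∅ := by
        refine Set.eq_empty_of_forall_notMem fun ξ hξ => hBΛ (shiftMatrix_ofCross_mem M hξ).1
      rw [this]
      simp

/-- Markov's inequality for the number of events `A a` that occur. -/
theorem mul_measureReal_le_sum {α : Type*} (s : Finset α) (A : α → Set Ω)
    (hA : ∀ a ∈ s, MeasurableSet (A a)) {S : Set Ω} {c : ℝ} (hc : 0 < c)
    (hS : ∀ ω ∈ S, c ≤ ∑ a ∈ s, (A a).indicator (fun _ => (1 : ℝ)) ω) :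
    c * μ.real S ≤ ∑ a ∈ s, μ.real (A a) := by
  have hint : ∀ a ∈ s, Integrable ((A a).indicator (fun _ => (1 : ℝ))) μ := fun a ha =>
    (integrable_const _).indicator (hA a ha)
  have h1 := mul_meas_ge_le_integral_of_nonneg (μ := μ)
    (f := fun ω => ∑ a ∈ s, (A a).indicator (fun _ => (1 : ℝ)) ω)
    (Eventually.of_forall fun ω => Finset.sum_nonneg fun a _ =>
      Set.indicator_nonneg (fun _ _ => zero_le_one) _)
    (integrable_finsetSum _ hint) c
  rw [integral_finsetSum _ hint] at h1
  have h2 : ∑ a ∈ s, ∫ ω, (A a).indicator (fun _ => (1 : ℝ)) ω ∂μ = ∑ a ∈ s, μ.real (A a) :=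
    Finset.sum_congr rfl fun a ha => by
      rw [integral_indicator_const _ (hA a ha), smul_eq_mul, mul_one]
  rw [h2] at h1
  exact le_trans (mul_le_mul_of_nonneg_left (measureReal_mono hS) hc.le) h1

theorem measureReal_exists_large_entry_le (hX : IsCorrelatedRandomMatrix μ ρ X) {b : ℝ}
    (hb : 0 < b) :
    μ.real {ω | ∃ i j, b ≤ |X ω i j|} ≤ n ^ 2 / b ^ 2 := by
  have h1 : ∀ i j, μ.real {ω | b ≤ |X ω i j|} ≤ 1 / b ^ 2 := by
    intro i j
    have h := mul_meas_ge_le_integral_of_nonneg (μ := μ) (f := fun ω => X ω i j ^ 2)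
      (Eventually.of_forall fun ω => sq_nonneg _) (hX.integrable_sq i j) (b ^ 2)
    rw [hX.variance_one i j] at h
    rw [le_div_iff₀ (by positivity), mul_comm]
    refine le_trans (mul_le_mul_of_nonneg_left (measureReal_mono fun ω hω => ?_)
      (by positivity)) h
    have hω' : b ≤ |X ω i j| := hω
    show b ^ 2 ≤ X ω i j ^ 2
    rw [← sq_abs (X ω i j)]
    gcongr
  have h2 : {ω | ∃ i j, b ≤ |X ω i j|} =
      ⋃ p ∈ (Finset.univ : Finset (Fin n × Fin n)), {ω | b ≤ |X ω p.1 p.2|} := by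
    ext ω; simp
  rw [h2]
  refine (measureReal_biUnion_finset_le _ _).trans
    ((Finset.sum_le_card_nsmul _ _ _ fun p _ => h1 p.1 p.2).trans (le_of_eq ?_))
  simp
  ring

/-- The bound on the probability of a nearly null vector at fixed `n` and with explicit
parameters. -/
theorem measureReal_exists_null_le (hX : IsCorrelatedRandomMatrix μ ρ X) {κ δ : ℝ} (hδ : 0 < δ)
    (hδ1 : δ ≤ 1) (hκ : 0 < κ)
    (hsp : ∀ j k, j ≠ k → IsSpreadLaw κ δ (μ.map fun ω => (X ω j k, X ω k j)))
    (M : Matrix (Fin n) (Fin n) 𝕜) {Λ τ s s' ε η b : ℝ} {m N : ℕ} (hτ : 0 < τ)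
    (hτ4 : τ ≤ 1 / 4) (hN : 1 ≤ N * τ) (hη : 0 < η) (hηs : η ≤ s) (hεs : ε ≤ s)
    (hm : 0 < m) (hb : 0 < b) (hM : ∀ i j, b + ‖M i j‖ ≤ Λ)
    (hmn : m < n) (hs : s + n * (Λ * (2 * τ)) ≤ s') (hs' : 4 * s' < κ)
    (hsmall : 4 * (((n - 1 : ℕ) : ℝ) * (ε + η) / τ) < κ * τ)
    (hsmall' : 8 * ((ε + ((n - 1 : ℕ) : ℝ) * (Λ / η * ε)) / τ) <
      κ * (τ * (κ / (((n - 1 : ℕ) : ℝ) * Λ)))) :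
    μ.real {ω | ∃ y : Fin n → 𝕜, ‖y‖ = 1 ∧
        ∀ i, ‖(shiftMatrix M (fun i j => X ω i j)).mulVec y i‖ ≤ ε} ≤
      n ^ 2 / b ^ 2 + (n * (scalarGrid 𝕜 τ N).card : ℕ) ^ m * (1 - δ / 2) ^ (n - 1) +
      n / m * (2 * ((n * (scalarGrid 𝕜 τ N).card : ℕ) ^ m * (1 - δ / 2) ^ (n - 2 - m / 2)) +
        √((1 - δ) ^ (m / 2) + 8 / √(δ * (m / 2)))) := by
  classical
  have hΛ : 0 < Λ := by
    have := hM ⟨0, by omega⟩ ⟨0, by omega⟩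
    have := norm_nonneg (M ⟨0, by omega⟩ ⟨0, by omega⟩)
    linarith
  set G := scalarGrid 𝕜 τ N with hG
  set A : Fin n → Set Ω := fun k => {ω | (fun i j => X ω i j) ∈ largeCoordEvent M Λ τ ε k} with hA
  have hXm : Measurable fun ω => (fun i j => X ω i j : Fin n → Fin n → ℝ) :=
    measurable_pi_lambda _ fun i => measurable_pi_lambda _ fun j => hX.measurable i j
  have hAm : ∀ k, MeasurableSet (A k) := fun k => hXm (measurableSet_largeCoordEvent M Λ τ ε k)
  set S : Set Ω := {ω | (m : ℝ) ≤ ∑ k, (A k).indicator (fun _ => (1 : ℝ)) ω} with hS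
  have hm' : (0 : ℝ) < m := by exact_mod_cast hm
  -- Either some entry is large, or the full matrix has a nearly null net vector, or `y` is spread
  -- and each of its large coordinates `k` witnesses `A k`.
  have hsub : {ω | ∃ y : Fin n → 𝕜, ‖y‖ = 1 ∧
        ∀ i, ‖(shiftMatrix M (fun i j => X ω i j)).mulVec y i‖ ≤ ε} ⊆
      ({ω | ∃ i j, b ≤ |X ω i j|} ∪
        {ω | (fun i j => X ω i j) ∈ netEvent M (Function.Embedding.refl _) Finset.univ m G s'}) ∪
      S := by
    rintro ω ⟨y, hy, hyε⟩
    by_contra hcon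
    simp only [Set.mem_union, not_or] at hcon
    obtain ⟨⟨h1, h2⟩, h3⟩ := hcon
    simp only [Set.mem_ofPred_eq] at h1
    push Not at h1
    have hent : ∀ i j, ‖shiftMatrix M (fun i j => X ω i j) i j‖ ≤ Λ := by
      intro i j
      refine le_trans (norm_add_le _ _) (le_trans ?_ (hM i j))
      rw [RCLike.norm_ofReal]
      have := h1 i j
      linarith
    have hspread : SpreadsNullVectors (shiftMatrix M (fun i j => X ω i j)) Finset.univ m τ s := by
      by_contra hns
      obtain ⟨z, hz, hzk, hzR⟩ := exists_mem_sparseNet_of_not_spreads hτ hτ4 hN hΛ.le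
        (by rw [Fintype.card_fin]; omega) hent hns
      rw [Fintype.card_fin] at hzR
      exact h2 ⟨z, hz, hzk, fun i hi => (hzR i hi).trans hs⟩
    have hcount := hspread y hy (fun i _ => (hyε i).trans hεs)
    apply h3
    simp only [hS, Set.mem_ofPred_eq]
    calc (m : ℝ) ≤ ((Finset.univ.filter fun j => τ < ‖y j‖).card : ℝ) := by exact_mod_cast hcount
      _ = ∑ k, if τ < ‖y k‖ then (1 : ℝ) else 0 := by simp
      _ ≤ ∑ k, (A k).indicator (fun _ => (1 : ℝ)) ω := by
        refine Finset.sum_le_sum fun k _ => ?_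
        split_ifs with hk
        · have : ω ∈ A k := ⟨hent, y, hy.le, hk.le, hyε⟩
          simp [this]
        · exact Set.indicator_nonneg (fun _ _ => zero_le_one) _
  refine (measureReal_mono hsub).trans ((measureReal_union_le _ _).trans (add_le_add
    ((measureReal_union_le _ _).trans (add_le_add (measureReal_exists_large_entry_le hX hb) ?_)) ?_))
  · have := measureReal_netEvent_le hX hδ hδ1 hκ hsp M (Function.Embedding.refl _) Finset.univ m G hs'
    simpa using this
  · have h1 := mul_measureReal_le_sum (μ := μ) Finset.univ A (fun k _ => hAm k) hm'
      (S := S) (fun ω hω => hω)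
    have h2 : ∑ k, μ.real (A k) ≤ n * (2 * ((n * G.card : ℕ) ^ m * (1 - δ / 2) ^ (n - 2 - m / 2)) +
        √((1 - δ) ^ (m / 2) + 8 / √(δ * (m / 2)))) := by
      refine (Finset.sum_le_card_nsmul _ _ _ fun k _ =>
        measureReal_largeCoordEvent_le hX hδ hδ1 hκ hsp M k hτ hτ4 hN hΛ hη hηs hm hmn hs hs' hsmall
          hsmall').trans (le_of_eq ?_)
      rw [Finset.card_univ, Fintype.card_fin, nsmul_eq_mul]
    rw [div_mul_eq_mul_div, le_div_iff₀ hm', mul_comm]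
    exact h1.trans h2

end

-- Asymptotics of the parameters.

theorem eventually_log_le_rpow (c : ℝ) (hc : 0 < c) :
    ∀ᶠ n : ℕ in atTop, Real.log n ≤ c * (n : ℝ) ^ (1 / 10 : ℝ) := by
  have h := ((isLittleO_log_rpow_atTop (r := 1 / 10) (by norm_num)).bound hc)
  filter_upwards [tendsto_natCast_atTop_atTop.eventually h] with n hn
  have h2 : 0 ≤ (n : ℝ) ^ (1 / 10 : ℝ) := by positivity
  rw [Real.norm_of_nonneg h2] at hn
  exact (le_abs_self _).trans hn

/-- Entropy against probability: `n ^ O(m)` is `exp (O(n ^ (9/10) * log n))`, and `log n ≤ c * n ^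
(1/10)` eventually. The constant `c` is tuned so that the exponent, including the extra factor `n`,
is at most `δ * n / 8`. -/
theorem eventually_sparsity_params (D : ℕ) {δ : ℝ} (hδ : 0 < δ) (y : ℝ) :
    ∀ᶠ n : ℕ in atTop, y ≤ n ∧ 2 ≤ ⌈(n : ℝ) ^ (9 / 10 : ℝ)⌉₊ ∧ ⌈(n : ℝ) ^ (9 / 10 : ℝ)⌉₊ < n ∧
      ((n : ℝ) ^ (2 * D + 6)) ^ ⌈(n : ℝ) ^ (9 / 10 : ℝ)⌉₊ * Real.exp (-(δ * n / 8)) ≤ 1 / n := by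
  have ht := tendsto_natCast_atTop_atTop (R := ℝ)
  filter_upwards [ht.eventually_ge_atTop y, ht.eventually_ge_atTop 4,
    ((tendsto_rpow_atTop (y := 1 / 10) (by norm_num)).comp ht).eventually_ge_atTop 2,
    ((tendsto_rpow_atTop (y := 9 / 10) (by norm_num)).comp ht).eventually_ge_atTop 2,
    eventually_log_le_rpow (δ / (16 * (2 * D + 7))) (by positivity)] with n h1 h4 h2 h9 hlog
  simp only [Function.comp_apply] at h2 h9
  set x : ℝ := (n : ℝ) with hx
  have hx0 : 0 < x := by linarith
  set m := ⌈x ^ (9 / 10 : ℝ)⌉₊ with hm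
  have hprod : x ^ (9 / 10 : ℝ) * x ^ (1 / 10 : ℝ) = x := by
    rw [← Real.rpow_add hx0]; norm_num
  have hmlt : (m : ℝ) < x ^ (9 / 10 : ℝ) + 1 := Nat.ceil_lt_add_one (by positivity)
  have hm2 : (2 : ℝ) ≤ m := h9.trans (Nat.le_ceil _)
  refine ⟨h1, by exact_mod_cast hm2, ?_, ?_⟩
  · have : (m : ℝ) < n := by nlinarith
    exact_mod_cast this
  · have hpow : (x ^ (2 * D + 6)) ^ m = Real.exp (m * ((2 * D + 6) * Real.log x)) := by
      rw [← Real.exp_log (x := (x ^ (2 * D + 6)) ^ m) (by positivity), Real.log_pow, Real.log_pow]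
      push_cast
      rfl
    have hinv : 1 / x = Real.exp (-Real.log x) := by
      rw [Real.exp_neg, Real.exp_log hx0, one_div]
    rw [hpow, hinv, ← Real.exp_add]
    refine Real.exp_le_exp.2 ?_
    have hl0 : 0 ≤ Real.log x := Real.log_nonneg (by linarith)
    have e1 : (m * (2 * D + 6) + 1) * Real.log x ≤
        (2 * x ^ (9 / 10 : ℝ) * (2 * D + 7)) * Real.log x := by
      refine mul_le_mul_of_nonneg_right ?_ hl0
      have hD : (0 : ℝ) ≤ D := Nat.cast_nonneg D
      have : (m : ℝ) ≤ 2 * x ^ (9 / 10 : ℝ) := by linarith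
      nlinarith
    have e2 : (2 * x ^ (9 / 10 : ℝ) * (2 * D + 7)) * Real.log x ≤
        (2 * x ^ (9 / 10 : ℝ) * (2 * D + 7)) * (δ / (16 * (2 * D + 7)) * x ^ (1 / 10 : ℝ)) := by
      gcongr
    have e3 : (2 * x ^ (9 / 10 : ℝ) * (2 * D + 7)) * (δ / (16 * (2 * D + 7)) * x ^ (1 / 10 : ℝ)) =
        δ * (x ^ (9 / 10 : ℝ) * x ^ (1 / 10 : ℝ)) / 8 := by
      field_simp
      norm_num
    rw [e3, hprod] at e2
    linarith

theorem sqrt_decoupling_bound_le {δ : ℝ} (hδ : 0 < δ) (hδ1 : δ ≤ 1) {m : ℕ} (hm : 2 ≤ m) :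
    (1 - δ) ^ (m / 2) + 8 / √(δ * (m / 2)) ≤ (4 / δ + 16 / √δ) / √m := by
  have hm0 : (0 : ℝ) < m := by exact_mod_cast (by omega : 0 < m)
  have hm1 : (1 : ℝ) ≤ m := by exact_mod_cast (by omega : 1 ≤ m)
  have hq : (m : ℝ) / 4 ≤ ((m / 2 : ℕ) : ℝ) := by
    rw [div_le_iff₀ (by norm_num)]
    exact_mod_cast (by omega : m ≤ m / 2 * 4)
  have h1 : (1 - δ) ^ (m / 2) ≤ (4 / δ) / √m := by
    have e1 : (1 - δ) ^ (m / 2) ≤ Real.exp (-(δ * m / 4)) := by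
      calc (1 - δ) ^ (m / 2) ≤ Real.exp (-δ) ^ (m / 2) :=
            pow_le_pow_left₀ (by linarith) (Real.one_sub_le_exp_neg δ) _
        _ = Real.exp (((m / 2 : ℕ) : ℝ) * -δ) := (Real.exp_nat_mul _ _).symm
        _ ≤ _ := Real.exp_le_exp.2 (by nlinarith)
    have e2 : Real.exp (-(δ * m / 4)) ≤ 1 / (δ * m / 4) := by
      rw [Real.exp_neg, inv_eq_one_div]
      exact one_div_le_one_div_of_le (by positivity)
        ((by linarith : δ * m / 4 ≤ δ * m / 4 + 1).trans (Real.add_one_le_exp _))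
    have e3 : 1 / (δ * m / 4) = (4 / δ) / m := by field_simp
    have e4 : √(m : ℝ) ≤ m := by
      rw [Real.sqrt_le_left (by linarith)]; nlinarith
    rw [e3] at e2
    refine e1.trans (e2.trans ?_)
    gcongr
  have h2 : 8 / √(δ * (m / 2)) ≤ (16 / √δ) / √m := by
    have e1 : √δ * √m / 2 ≤ √(δ * (m / 2)) := by
      refine Real.le_sqrt_of_sq_le ?_
      rw [div_pow, mul_pow, Real.sq_sqrt hδ.le, Real.sq_sqrt hm0.le]
      nlinarith [mul_pos hδ hm0]
    have e2 : 0 < √δ * √m / 2 := by positivity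
    calc 8 / √(δ * (m / 2)) ≤ 8 / (√δ * √m / 2) := by gcongr
      _ = (16 / √δ) / √m := by field_simp; norm_num
  rw [add_div]
  exact add_le_add h1 h2

theorem pow_mul_one_sub_pow_le {x δ g : ℝ} {D m r : ℕ} (hδ : 0 < δ) (hδ1 : δ ≤ 1) (hg0 : 0 ≤ g)
    (hg : g ≤ x ^ (2 * D + 6)) (hr : x ≤ 4 * r)
    (h : (x ^ (2 * D + 6)) ^ m * Real.exp (-(δ * x / 8)) ≤ 1 / x) :
    g ^ m * (1 - δ / 2) ^ r ≤ 1 / x := by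
  refine le_trans (mul_le_mul (pow_le_pow_left₀ hg0 hg m) ?_ (pow_nonneg (by linarith) _)
    (pow_nonneg (hg0.trans hg) m)) h
  calc (1 - δ / 2) ^ r ≤ Real.exp (-(δ / 2)) ^ r :=
        pow_le_pow_left₀ (by linarith) (Real.one_sub_le_exp_neg _) _
    _ = Real.exp ((r : ℝ) * -(δ / 2)) := (Real.exp_nat_mul _ _).symm
    _ ≤ _ := Real.exp_le_exp.2 (by nlinarith)

/-- The dominant term is `x / m * √w`, of order `x ^ (1/10) * x ^ (-9/40) = x ^ (-1/8)`. This fixes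
the final exponent. -/
theorem total_bound_le {x m q C : ℝ} (hx : 1 ≤ x) (hm : x ^ (9 / 10 : ℝ) ≤ m) (hC : 0 ≤ C)
    (hq : q ≤ 1 / x) {w q' : ℝ} (hw : w ≤ C / √m) (hq' : q' ≤ 1 / x) :
    x ^ 2 / (x ^ 2) ^ 2 + q + x / m * (2 * q' + √w) ≤ (4 + √C) * x ^ (-(1 / 8) : ℝ) := by
  have hx0 : 0 < x := by linarith
  have hm0 : 0 < m := lt_of_lt_of_le (by positivity) hm
  have hxm : x / m ≤ x ^ (1 / 10 : ℝ) := by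
    rw [div_le_iff₀ hm0]
    calc x = x ^ (1 / 10 : ℝ) * x ^ (9 / 10 : ℝ) := by rw [← Real.rpow_add hx0]; norm_num
      _ ≤ _ := by gcongr
  have hx1 : 1 / x = x ^ (-1 : ℝ) := by rw [Real.rpow_neg_one, one_div]
  have hmono : ∀ a b : ℝ, a ≤ b → x ^ a ≤ x ^ b := fun a b hab =>
    Real.rpow_le_rpow_of_exponent_le hx hab
  have h1 : x ^ 2 / (x ^ 2) ^ 2 ≤ x ^ (-(1 / 8) : ℝ) := by
    have : x ^ 2 / (x ^ 2) ^ 2 = x ^ (-2 : ℝ) := by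
      rw [Real.rpow_neg hx0.le, show (2 : ℝ) = ((2 : ℕ) : ℝ) by norm_num, Real.rpow_natCast]
      field_simp
    rw [this]
    exact hmono _ _ (by norm_num)
  have h2 : q ≤ x ^ (-(1 / 8) : ℝ) := by
    refine hq.trans ?_
    rw [hx1]
    exact hmono _ _ (by norm_num)
  have h3 : √w ≤ √C * x ^ (-(9 / 40) : ℝ) := by
    have e1 : C / √m ≤ C * x ^ (-(9 / 20) : ℝ) := by
      rw [div_eq_mul_inv]
      refine mul_le_mul_of_nonneg_left ?_ hC
      rw [Real.rpow_neg hx0.le]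
      refine inv_anti₀ (by positivity) (Real.le_sqrt_of_sq_le ?_)
      rw [← Real.rpow_natCast, ← Real.rpow_mul hx0.le]
      refine le_trans (le_of_eq ?_) hm
      norm_num
    have e2 : x ^ (-(9 / 20) : ℝ) = (x ^ (-(9 / 40) : ℝ)) ^ 2 := by
      rw [← Real.rpow_natCast, ← Real.rpow_mul hx0.le]
      norm_num
    calc √w ≤ √(C * x ^ (-(9 / 20) : ℝ)) := Real.sqrt_le_sqrt (hw.trans e1)
      _ = √C * x ^ (-(9 / 40) : ℝ) := by
        rw [Real.sqrt_mul hC, e2, Real.sqrt_sq (by positivity)]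
  have h4 : x / m * (2 * q' + √w) ≤ x ^ (1 / 10 : ℝ) * (2 * x ^ (-1 : ℝ) + √C * x ^ (-(9 / 40) : ℝ)) := by
    calc _ ≤ x / m * (2 * x ^ (-1 : ℝ) + √C * x ^ (-(9 / 40) : ℝ)) := by
          rw [← hx1]
          gcongr
      _ ≤ _ := by gcongr
  have h5 : x ^ (1 / 10 : ℝ) * (2 * x ^ (-1 : ℝ) + √C * x ^ (-(9 / 40) : ℝ)) ≤
      (2 + √C) * x ^ (-(1 / 8) : ℝ) := by
    have e1 : x ^ (1 / 10 : ℝ) * x ^ (-1 : ℝ) ≤ x ^ (-(1 / 8) : ℝ) := by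
      rw [← Real.rpow_add hx0]
      exact hmono _ _ (by norm_num)
    have e2 : x ^ (1 / 10 : ℝ) * x ^ (-(9 / 40) : ℝ) = x ^ (-(1 / 8) : ℝ) := by
      rw [← Real.rpow_add hx0]
      norm_num
    calc _ = 2 * (x ^ (1 / 10 : ℝ) * x ^ (-1 : ℝ)) +
          √C * (x ^ (1 / 10 : ℝ) * x ^ (-(9 / 40) : ℝ)) := by ring
      _ ≤ 2 * x ^ (-(1 / 8) : ℝ) + √C * x ^ (-(1 / 8) : ℝ) := by rw [e2]; gcongr
      _ = _ := by ring
  linarith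

-- Choice of scales and conclusion.

section
variable {𝕜 : Type*} [RCLike 𝕜] {n : ℕ}
  {Ω : Type*} [MeasurableSpace Ω] {μ : Measure Ω} [IsProbabilityMeasure μ] {ρ : ℝ}
  {X : Ω → Matrix (Fin n) (Fin n) ℝ}

/-- The bound for all large `n`, with the scales chosen as powers of `n`. -/
theorem measureReal_exists_null_le_rpow (hX : IsCorrelatedRandomMatrix μ ρ X) {κ δ : ℝ}
    (hδ : 0 < δ) (hδ1 : δ ≤ 1) (hκ : 0 < κ)
    (hsp : ∀ j k, j ≠ k → IsSpreadLaw κ δ (μ.map fun ω => (X ω j k, X ω k j)))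
    (M : Matrix (Fin n) (Fin n) 𝕜) {K : ℝ} {d : ℕ} (hM : ∀ i j, ‖M i j‖ ≤ K * (n : ℝ) ^ d)
    (hn : max 32 (max (K + 1) (max (64 / κ) (32 / κ ^ 2))) ≤ n)
    (hm2 : 2 ≤ ⌈(n : ℝ) ^ (9 / 10 : ℝ)⌉₊) (hmn : ⌈(n : ℝ) ^ (9 / 10 : ℝ)⌉₊ < n)
    (hlarge : ((n : ℝ) ^ (2 * (d + 3) + 6)) ^ ⌈(n : ℝ) ^ (9 / 10 : ℝ)⌉₊ *
      Real.exp (-(δ * n / 8)) ≤ 1 / n) :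
    μ.real {ω | ∃ y : Fin n → 𝕜, ‖y‖ = 1 ∧
        ∀ i, ‖(shiftMatrix M (fun i j => X ω i j)).mulVec y i‖ ≤ 1 / (n : ℝ) ^ (6 * (d + 3) + 13)} ≤
      (4 + √(4 / δ + 16 / √δ)) * (n : ℝ) ^ (-(1 / 8) : ℝ) := by
  set D := d + 3 with hD
  set m := ⌈(n : ℝ) ^ (9 / 10 : ℝ)⌉₊ with hm
  simp only [max_le_iff] at hn
  obtain ⟨hn32, hnK, hnκ, hnκ2⟩ := hn
  have hnat : 32 ≤ n := by exact_mod_cast hn32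
  set x : ℝ := (n : ℝ) with hx
  have hx0 : 0 < x := by linarith
  have hx1 : 1 ≤ x := by linarith
  set P : ℝ := x ^ D with hP
  have hP1 : 1 ≤ P := one_le_pow₀ hx1
  have hP0 : 0 < P := by linarith
  have hκx : 64 / x ≤ κ := by
    rw [div_le_iff₀ hκ] at hnκ
    rw [div_le_iff₀ hx0]
    linarith
  have hκx2 : 32 / x ≤ κ ^ 2 := by
    rw [div_le_iff₀ (by positivity)] at hnκ2
    rw [div_le_iff₀ hx0]
    linarith
  have hix : 0 < 1 / x := by positivity
  have e64 : 64 / x = 64 * (1 / x) := by ring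
  have e32 : 32 / x = 32 * (1 / x) := by ring
  have hτe : (1 : ℝ) / x ^ (D + 2) = 1 / (P * x ^ 2) := by rw [hP]; ring
  have hηe : (1 : ℝ) / x ^ (2 * D + 6) = 1 / (P ^ 2 * x ^ 6) := by rw [hP]; ring
  have hεe : (1 : ℝ) / x ^ (6 * D + 13) = 1 / (P ^ 6 * x ^ 13) := by rw [hP]; ring
  have hn1 : ((n - 1 : ℕ) : ℝ) ≤ x := Nat.cast_le.2 (Nat.sub_le n 1)
  have hn1' : (0 : ℝ) < ((n - 1 : ℕ) : ℝ) := by exact_mod_cast (by omega : 0 < n - 1)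
  have hηx : 1 / x ^ (2 * D + 6) ≤ 1 / x :=
    one_div_le_one_div_of_le hx0 (le_self_pow₀ hx1 (by omega))
  have hεη : 1 / x ^ (6 * D + 13) ≤ 1 / x ^ (2 * D + 6) :=
    one_div_le_one_div_of_le (by positivity) (pow_le_pow_right₀ hx1 (by omega))
  have hτ4 : 1 / x ^ (D + 2) ≤ 1 / 4 := by
    refine one_div_le_one_div_of_le (by norm_num) ?_
    exact (by linarith : (4 : ℝ) ≤ x).trans (le_self_pow₀ hx1 (by omega))
  have hmpos : 0 < m := by omega
  -- With `P = x ^ D`: `Λ = P` absorbs `x ^ 2 + K * x ^ d`; `τ = 1 / (P x²)` makes the rounding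
  -- error `2 / x`; `η = 1 / (P² x⁶)` makes `x η / τ` smaller than `τ` by a factor `x`; `ε = 1 / (P⁶
  -- x¹³)` makes the Schur complement error `x Λ ε / (η τ)` smaller than `τ / (x Λ)` by a factor
  -- `x`.
  have key := measureReal_exists_null_le hX hδ hδ1 hκ hsp M (Λ := P) (τ := 1 / x ^ (D + 2))
    (s := κ / 16) (s' := κ / 8) (ε := 1 / x ^ (6 * D + 13)) (η := 1 / x ^ (2 * D + 6))
    (b := x ^ 2) (m := m) (N := n ^ (D + 2)) (by positivity) hτ4
    (by push_cast; rw [mul_one_div, div_self (by positivity)]) (by positivity)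
    (by linarith) (by linarith) hmpos (by positivity) ?_ hmn ?_ (by linarith) ?_ ?_
  rotate_left
  · intro i j
    have hd1 : 1 ≤ x ^ d := one_le_pow₀ hx1
    have e : P = x ^ d * x ^ 3 := by rw [hP, hD, pow_add]
    have h1 := hM i j
    rw [e]
    have h2 : K ≤ x - 1 := by linarith
    have h3 : x ^ 2 + K ≤ x ^ 3 := by nlinarith [sq_nonneg (x - 1)]
    have h4 : x ^ 2 ≤ x ^ d * x ^ 2 := le_mul_of_one_le_left (by positivity) hd1
    have h5 : x ^ d * (x ^ 2 + K) ≤ x ^ d * x ^ 3 := by gcongr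
    linarith
  · rw [hτe]
    have : x * (P * (2 * (1 / (P * x ^ 2)))) = 2 * (1 / x) := by field_simp
    linarith
  · have h1 : 4 * (((n - 1 : ℕ) : ℝ) * (1 / x ^ (6 * D + 13) + 1 / x ^ (2 * D + 6)) /
        (1 / x ^ (D + 2))) ≤
        4 * (x * (1 / x ^ (2 * D + 6) + 1 / x ^ (2 * D + 6)) / (1 / x ^ (D + 2))) := by
      gcongr
    refine h1.trans_lt ?_
    rw [hτe, hηe]
    have h2 : 4 * (x * (1 / (P ^ 2 * x ^ 6) + 1 / (P ^ 2 * x ^ 6)) / (1 / (P * x ^ 2))) =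
        8 * (1 / x) * (1 / (P * x ^ 2)) := by
      field_simp
      ring
    rw [h2]
    refine mul_lt_mul_of_pos_right ?_ (by positivity)
    linarith
  · have h1 : 1 / x ^ (6 * D + 13) + ((n - 1 : ℕ) : ℝ) *
        (P / (1 / x ^ (2 * D + 6)) * (1 / x ^ (6 * D + 13))) ≤
        2 * (x * (P / (1 / x ^ (2 * D + 6)) * (1 / x ^ (6 * D + 13)))) := by
      have t1 : ((n - 1 : ℕ) : ℝ) * (P / (1 / x ^ (2 * D + 6)) * (1 / x ^ (6 * D + 13))) ≤
          x * (P / (1 / x ^ (2 * D + 6)) * (1 / x ^ (6 * D + 13))) := by gcongr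
      have t2 : 1 ≤ x * (P / (1 / x ^ (2 * D + 6))) := by
        rw [div_div_eq_mul_div, div_one]
        exact one_le_mul_of_one_le_of_one_le hx1
          (one_le_mul_of_one_le_of_one_le hP1 (one_le_pow₀ hx1))
      have t3 : 1 / x ^ (6 * D + 13) ≤
          x * (P / (1 / x ^ (2 * D + 6)) * (1 / x ^ (6 * D + 13))) := by
        rw [← mul_assoc]
        exact le_mul_of_one_le_left (by positivity) t2
      linarith
    have h2 : 8 * ((1 / x ^ (6 * D + 13) + ((n - 1 : ℕ) : ℝ) *
        (P / (1 / x ^ (2 * D + 6)) * (1 / x ^ (6 * D + 13)))) / (1 / x ^ (D + 2))) ≤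
        8 * (2 * (x * (P / (1 / x ^ (2 * D + 6)) * (1 / x ^ (6 * D + 13)))) / (1 / x ^ (D + 2))) := by
      gcongr
    refine h2.trans_lt (lt_of_lt_of_le ?_ (?_ : κ * (1 / x ^ (D + 2) * (κ / (x * P))) ≤ _))
    · rw [hτe, hηe, hεe]
      have e1 : 8 * (2 * (x * (P / (1 / (P ^ 2 * x ^ 6)) * (1 / (P ^ 6 * x ^ 13)))) /
          (1 / (P * x ^ 2))) = 16 * (1 / x) * (1 / (P ^ 2 * x ^ 3)) := by
        field_simp
        ring
      have e2 : κ * (1 / (P * x ^ 2) * (κ / (x * P))) = κ ^ 2 * (1 / (P ^ 2 * x ^ 3)) := by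
        field_simp
      rw [e1, e2]
      refine mul_lt_mul_of_pos_right ?_ (by positivity)
      linarith
    · gcongr
  refine key.trans ?_
  have hgrid : ((n * (scalarGrid 𝕜 (1 / x ^ (D + 2)) (n ^ (D + 2))).card : ℕ) : ℝ) ≤
      x ^ (2 * D + 6) := by
    have h1 : n * (scalarGrid 𝕜 (1 / x ^ (D + 2)) (n ^ (D + 2))).card ≤ n ^ (2 * D + 6) := by
      calc _ ≤ n * (2 * n ^ (D + 2) + 1) ^ 2 := Nat.mul_le_mul_left _ (card_scalarGrid_le _ _)
        _ ≤ n * (3 * n ^ (D + 2)) ^ 2 := by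
          have : 1 ≤ n ^ (D + 2) := Nat.one_le_pow _ _ (by omega)
          gcongr
          omega
        _ = 9 * n ^ (2 * D + 5) := by ring
        _ ≤ n * n ^ (2 * D + 5) := Nat.mul_le_mul_right _ (by omega)
        _ = n ^ (2 * D + 6) := by ring
    exact (Nat.cast_le.2 h1).trans_eq (Nat.cast_pow _ _)
  refine total_bound_le hx1 (Nat.le_ceil _) (by positivity) ?_
    (sqrt_decoupling_bound_le hδ hδ1 hm2) ?_
  · refine pow_mul_one_sub_pow_le hδ hδ1 (Nat.cast_nonneg _) hgrid ?_ hlarge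
    rw [hx]
    exact_mod_cast (by omega : n ≤ 4 * (n - 1))
  · refine pow_mul_one_sub_pow_le hδ hδ1 (Nat.cast_nonneg _) hgrid ?_ hlarge
    rw [hx]
    exact_mod_cast (by omega : n ≤ 4 * (n - 2 - m / 2))

end

theorem theorem1 {𝕜 : Type*} [RCLike 𝕜] (K Q : ℝ) (hK : 0 < K) (hQ : 0 ≤ Q) :
    ∃ A B : ℝ, 0 < A ∧ 0 < B ∧
      ∀ (ρ : ℝ) (φ : ℝ → ℝ), |ρ| < 1 → Tendsto φ atTop (𝓝 0) →
        ∃ C : ℝ, 0 < C ∧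
          ∀ (n : ℕ) (Ω : Type*) [MeasurableSpace Ω] (μ : Measure Ω) [IsProbabilityMeasure μ]
            (X : Ω → Matrix (Fin n) (Fin n) ℝ) (M : Matrix (Fin n) (Fin n) 𝕜),
            1 ≤ n →
            IsCorrelatedRandomMatrix μ ρ X →
            HasSquareUIModulus μ φ X →
            ‖Matrix.toEuclideanCLM (n := Fin n) (𝕜 := 𝕜) M‖ ≤ K * (n : ℝ) ^ Q →
            μ.real {ω | leastSingularValue ((X ω).map (fun x : ℝ => (x : 𝕜)) + M)
              ≤ (n : ℝ) ^ (-B)} ≤ C * (n : ℝ) ^ (-A) := by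
  set d := ⌈Q⌉₊ with hd
  -- One power of `n` beyond the exponent `6 * (d + 3) + 13` of `ε` pays for the passage to the sup
  -- norm.
  refine ⟨1 / 8, ((6 * (d + 3) + 14 : ℕ) : ℝ), by norm_num, by positivity, fun ρ φ hρ hφ => ?_⟩
  have hθ : 0 < 1 - |ρ| := by linarith
  obtain ⟨T, hT1, hφT⟩ : ∃ T : ℝ, 1 ≤ T ∧ φ T ≤ (1 - |ρ|) / 128 :=
    ((eventually_ge_atTop 1).and (hφ.eventually_le_const (by positivity))).exists
  set κ := √((1 - |ρ|) / 2) with hκ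
  set δ := (1 - |ρ|) / (16 * T ^ 2) with hδ
  have hκ0 : 0 < κ := by positivity
  have hδ0 : 0 < δ := by positivity
  have hδ1 : δ ≤ 1 := by
    rw [hδ, div_le_one (by positivity)]
    nlinarith [abs_nonneg ρ]
  obtain ⟨n₀, hn₀⟩ := eventually_atTop.1 (eventually_sparsity_params (d + 3) hδ0
    (max 32 (max (K + 1) (max (64 / κ) (32 / κ ^ 2)))))
  -- The first summand makes the bound at least 1, hence trivial, for `n < n₀`.
  refine ⟨(n₀ : ℝ) ^ (1 / 8 : ℝ) + (4 + √(4 / δ + 16 / √δ)), by positivity,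
    fun n Ω _ μ _ X M hn hX hUI hM => ?_⟩
  have hn0 : (0 : ℝ) < n := by exact_mod_cast hn
  have hn1 : (1 : ℝ) ≤ n := by exact_mod_cast hn
  have hneg : (0 : ℝ) < (n : ℝ) ^ (-(1 / 8) : ℝ) := by positivity
  rw [add_mul]
  rcases lt_or_ge n n₀ with hlt | hge
  · have h1 : (1 : ℝ) ≤ (n₀ : ℝ) ^ (1 / 8 : ℝ) * (n : ℝ) ^ (-(1 / 8) : ℝ) := by
      rw [Real.rpow_neg hn0.le, ← div_eq_mul_inv, one_le_div (by positivity)]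
      gcongr
    have h2 : 0 ≤ (4 + √(4 / δ + 16 / √δ)) * (n : ℝ) ^ (-(1 / 8) : ℝ) := by positivity
    exact measureReal_le_one.trans (by linarith)
  · obtain ⟨h1, h2, h3, h4⟩ := hn₀ n hge
    have hMd : ∀ i j, ‖M i j‖ ≤ K * (n : ℝ) ^ d := fun i j => by
      refine (norm_entry_le_norm_toEuclideanCLM M i j).trans (hM.trans ?_)
      rw [← Real.rpow_natCast]
      gcongr
      exact Nat.le_ceil Q
    have hmain := measureReal_exists_null_le_rpow hX hδ0 hδ1 hκ0
      (fun j k hjk => hX.isSpreadLaw hUI hρ hT1 hφT hjk) M hMd h1 h2 h3 h4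
    refine (measureReal_mono fun ω hω => ?_).trans (hmain.trans (le_add_of_nonneg_left (by positivity)))
    obtain ⟨y, hy, hyi⟩ := exists_norm_mulVec_le_of_leastSingularValue_le hn hω
    refine ⟨y, hy, fun i => (hyi i).trans (le_of_eq ?_)⟩
    rw [Real.rpow_neg hn0.le, Real.rpow_natCast,
      show 6 * (d + 3) + 14 = (6 * (d + 3) + 13) + 1 by ring, pow_succ]
    field_simp
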